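/- **Setting.** Let $d\in\{2,3\}$, let $\Omega\subset\mathbb{R}^d$ be a bounded open set, let $\kappa,\eta,\tau>0$ and $H\in L^2(\Omega)$ (scalar-valued if $d=2$, $\mathbb{R}^3$-valued if $d=3$; $\mathbf{curl}$ is correspondingly the scalar $\partial_1A_2-\partial_2A_1$ or the usual vector curl). For complex $\psi$ and real vector fields $\mathbf{A}$ put $$\mathcal{G}(\psi,\mathbf{A})=\int_\Omega\Big|\frac{i}{\kappa}\nabla\psi+\mathbf{A}\psi\Big|^2+\frac12(|\psi|^2-1)^2+|\mathbf{curl}\,\mathbf{A}-H|^2+|\nabla\cdot\mathbf{A}|^2,$$ $$\mathcal{K}_\tau(\psi,\psi',\mathbf{A},\mathbf{A}')=\int_\Omega\Big|\frac{\psi-\psi'}{\tau}\Big|^2+\Big|\frac{\mathbf{A}-\mathbf{A}'}{\tau}\Big|^2 .$$ Let $\psi^0\in H^1(\Omega;\mathbb{C})$ with $|\psi^0|\le1$ a.e., $\mathbf{A}^0\in H^1(\Omega;\mathbb{R}^d)$ with $\mathbf{A}^0\cdot\mathbf{n}=0$ on $\partial\Omega$ (in the sense of Green's formula), and $r^0=\mathcal{G}(\psi^0,\mathbf{A}^0)$.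 For $1\le n\le M$ let $\bar\psi^n,\mathbf{A}^n,\tilde r^n,\zeta^n,\psi^n,r^n,\alpha_0^n,\gamma^n$ satisfy the following. *Step 1.* $(\bar\psi^n,\mathbf{A}^n)$ is a weak $H^1$ solution of $$\eta\frac{\bar\psi^n-\psi^{n-1}}{\tau}+\Big(\frac{i}{\kappa}\nabla+\mathbf{A}^{n-1}\Big)^2\bar\psi^n+|\psi^{n-1}|^2\bar\psi^n-\psi^{n-1}=0,$$ $$\frac{\mathbf{A}^n-\mathbf{A}^{n-1}}{\tau}+\mathbf{curl}\,\mathbf{curl}\,\mathbf{A}^n-\nabla(\nabla\cdot\mathbf{A}^n)+\frac{i}{2\kappa}(\bar\psi^{n*}\nabla\bar\psi^n-\bar\psi^n\nabla\bar\psi^{n*})+|\bar\psi^n|^2\mathbf{A}^n=\mathbf{curl}\,H,$$ with the boundary conditions $(\frac{i}{\kappa}\nabla\bar\psi^n+\mathbf{A}^{n-1}\bar\psi^n)\cdot\mathbf{n}=0$, $\mathbf{curl}\,\mathbf{A}^n\times\mathbf{n}=H\times\mathbf{n}$, $\mathbf{A}^n\cdot\mathbf{n}=0$ (the first two being natural,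 i.e. contained in the weak form), where $\bar\psi^n\in L^4(\Omega)$ and $\mathbf{A}^{n-1}\bar\psi^n,\mathbf{A}^n\bar\psi^n\in L^2(\Omega)$ and the test functions $\varphi\in H^1(\Omega;\mathbb{C})$ and $v\in H^1(\Omega;\mathbb{R}^d)$, $v\cdot\mathbf{n}=0$, range over those with $\varphi\in L^4$, $\mathbf{A}^{n-1}\varphi\in L^2$ and $\bar\psi^nv\in L^2$ (all these integrability conditions are automatic on Lipschitz domains); and, with $\bar{\mathcal{K}}^n=\mathcal{K}_\tau(\bar\psi^n,\psi^{n-1},\mathbf{A}^n,\mathbf{A}^{n-1})$ and $\mathcal{K}^n=\mathcal{K}_\tau(\psi^n,\psi^{n-1},\mathbf{A}^n,\mathbf{A}^{n-1})$, $$\frac{\tilde r^n-r^{n-1}}{\tau}=-\frac{\tilde r^n}{\mathcal{G}(\bar\psi^n,\mathbf{A}^n)}\bar{\mathcal{K}}^n .$$ *Step 2.* $\zeta^n=\min\{\tilde r^n/\mathcal{G}(\bar\psi^n,\mathbf{A}^n),\,1+\sqrt2\}$, $\ \xi^n=1-(1-\zeta^n)^2$, $\ \psi^n=\xi^n\bar\psi^n$.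 *Step 3.* $r^n=\alpha_0^n\tilde r^n+(1-\alpha_0^n)\mathcal{G}(\psi^n,\mathbf{A}^n)$, with $\alpha_0^n,\gamma^n$ chosen by the rule: 1. if $\tilde r^n=\mathcal{G}(\psi^n,\mathbf{A}^n)$, then $\alpha_0^n=0$, $\gamma^n=\dfrac{\tilde r^n\bar{\mathcal{K}}^n}{\mathcal{G}(\bar\psi^n,\mathbf{A}^n)\mathcal{K}^n}$; 2. if $\tilde r^n>\mathcal{G}(\psi^n,\mathbf{A}^n)$, then $\alpha_0^n=0$, $\gamma^n=\dfrac{\tilde r^n-\mathcal{G}(\psi^n,\mathbf{A}^n)}{\tau\mathcal{K}^n}+\dfrac{\tilde r^n\bar{\mathcal{K}}^n}{\mathcal{G}(\bar\psi^n,\mathbf{A}^n)\mathcal{K}^n}$; 3. if $\tilde r^n<\mathcal{G}(\psi^n,\mathbf{A}^n)$ and $\tilde r^n-\mathcal{G}(\psi^n,\mathbf{A}^n)+\tau\dfrac{\tilde r^n}{\mathcal{G}(\bar\psi^n,\mathbf{A}^n)}\bar{\mathcal{K}}^n\ge0$, then $\alpha_0^n=0$ and $\gamma^n$ is as in case 2;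 4. if $\tilde r^n<\mathcal{G}(\psi^n,\mathbf{A}^n)$ and $\tilde r^n-\mathcal{G}(\psi^n,\mathbf{A}^n)+\tau\dfrac{\tilde r^n}{\mathcal{G}(\bar\psi^n,\mathbf{A}^n)}\bar{\mathcal{K}}^n<0$, then $\alpha_0^n=1-\dfrac{\tau\tilde r^n\bar{\mathcal{K}}^n}{\mathcal{G}(\bar\psi^n,\mathbf{A}^n)(\mathcal{G}(\psi^n,\mathbf{A}^n)-\tilde r^n)}$, $\gamma^n=0$. (Quotients with denominator $0$ are read as $0$.) **Theorem.** For every $1\le n\le M$: - if $\tau\le\eta$ and $r^{n-1}>0$, then $r^n>0$ and $\zeta^n>0$; - in cases 1–3 (for every $\tau>0$), $\mathcal{G}(\psi^n,\mathbf{A}^n)\le\mathcal{G}(\psi^{n-1},\mathbf{A}^{n-1})$; - in case 4, if $\tau\le\eta$, $\mathcal{G}(\bar\psi^n,\mathbf{A}^n)\le\mathcal{G}(\psi^{n-1},\mathbf{A}^{n-1})$. -/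

import Mathlib

open MeasureTheory

noncomputable section

namespace GLSAV

/-- Euclidean space `ℝ^d`. -/
abbrev E (d : ℕ) := EuclideanSpace ℝ (Fin d)

/-- The `j`-th standard basis vector of `ℝ^d`. -/
abbrev basisVec {d : ℕ} (j : Fin d) : E d := EuclideanSpace.single j (1 : ℝ)

/-! ### Sobolev spaces -/

section Sobolev

variable {d : ℕ} {F : Type*} [NormedAddCommGroup F] [NormedSpace ℝ F]

/-- `g` is a weak partial derivative `∂_j u` on `Ω`:
`∫_Ω (∂_j φ) u = - ∫_Ω φ g` for all test functions `φ ∈ C_c^∞(Ω)`. -/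
def HasWeakPartial (Ω : Set (E d)) (j : Fin d) (u g : E d → F) : Prop :=
  ∀ φ : E d → ℝ, ContDiff ℝ (⊤ : ℕ∞) φ → HasCompactSupport φ → tsupport φ ⊆ Ω →
    ∫ x in Ω, (fderiv ℝ φ x (basisVec j)) • u x = - ∫ x in Ω, φ x • g x

/-- `u ∈ H¹(Ω; F)`: `u` and its weak first partial derivatives are square integrable on `Ω`. -/
def MemH1 (Ω : Set (E d)) (u : E d → F) : Prop :=
  MemLp u 2 (volume.restrict Ω) ∧
    ∀ j : Fin d, ∃ g : E d → F, MemLp g 2 (volume.restrict Ω) ∧ HasWeakPartial Ω j u g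

open Classical in
/-- The weak partial derivative `∂_j u ∈ L²(Ω; F)` (unique up to null sets if it exists;
`0` if there is none). -/
def weakPartial (Ω : Set (E d)) (j : Fin d) (u : E d → F) : E d → F :=
  if h : ∃ g : E d → F, MemLp g 2 (volume.restrict Ω) ∧ HasWeakPartial Ω j u g then
    h.choose
  else 0

end Sobolev

/-! ### Divergence, curl and the condition `A · n = 0` -/

/-- The curl computed from the Jacobian `J i j = ∂_j A_i`. For `d = 2` it is the scalar
`∂₁A₂ - ∂₂A₁` (a vector with one component), for `d = 3` the usual vector; it is only used for
these two values of `d`. -/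
def curlOfJacobian : (d : ℕ) → (Fin d → Fin d → ℝ) → E (d.choose 2)
  | 2, J => WithLp.toLp 2 (fun _ => J 1 0 - J 0 1)
  | 3, J => WithLp.toLp 2
      (![J 2 1 - J 1 2, J 0 2 - J 2 0, J 1 0 - J 0 1] : Fin 3 → ℝ)
  | _, _ => 0

variable {d : ℕ}

/-- The weak curl of a vector field on `Ω`. -/
def curl (Ω : Set (E d)) (A : E d → E d) (x : E d) : E (d.choose 2) :=
  curlOfJacobian d (fun i j => (weakPartial Ω j A x) i)

/-- The weak divergence of a vector field on `Ω`. -/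
def divergence (Ω : Set (E d)) (A : E d → E d) (x : E d) : ℝ :=
  ∑ i : Fin d, (weakPartial Ω i A x) i

/-- `H¹_n(Ω)`: vector fields `A ∈ H¹(Ω; ℝ^d)` with `A · n = 0` on `∂Ω`. The boundary condition is
expressed by Green's formula `∫_Ω (A · ∇φ + (div A) φ) = ∫_{∂Ω} (A · n) φ = 0` for all
`φ ∈ C_c^∞(ℝ^d)` (not required to vanish on the boundary). -/
def MemH1n (Ω : Set (E d)) (A : E d → E d) : Prop :=
  MemH1 Ω A ∧
    ∀ φ : E d → ℝ, ContDiff ℝ (⊤ : ℕ∞) φ → HasCompactSupport φ →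
      ∫ x in Ω, ((∑ i : Fin d, A x i * fderiv ℝ φ x (basisVec i)) + divergence Ω A x * φ x) = 0

/-- `ψ ∈ H¹(Ω; ℂ)`, together with `ψ ∈ L⁴` and `|ψ| A ∈ L²`, so that `(ψ, A)` has finite
Ginzburg-Landau energy. If `A ∈ H¹`, `d ≤ 3` and `Ω` is a bounded Lipschitz domain, the two
additional conditions hold for every `ψ ∈ H¹(Ω; ℂ)` by the Sobolev embedding `H¹ ⊆ L⁶`. -/
def MemMagH1 (Ω : Set (E d)) (A : E d → E d) (ψ : E d → ℂ) : Prop :=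
  MemH1 Ω ψ ∧ MemLp ψ 4 (volume.restrict Ω) ∧
    MemLp (fun x => ‖ψ x‖ • A x) 2 (volume.restrict Ω)

/-! ### The Ginzburg-Landau energy -/

/-- The `j`-th component of `(i/κ) ∇ψ + A ψ`. -/
def covGrad (Ω : Set (E d)) (κ : ℝ) (A : E d → E d) (ψ : E d → ℂ) (j : Fin d) (x : E d) : ℂ :=
  (Complex.I / (κ : ℂ)) * weakPartial Ω j ψ x + (A x j : ℂ) * ψ x

/-- The Ginzburg-Landau free energy
`𝒢(ψ, A) = ∫_Ω |(i/κ)∇ψ + Aψ|² + ½ (|ψ|² - 1)² + |curl A - H|² + |div A|²`. -/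
def energy (Ω : Set (E d)) (κ : ℝ) (H : E d → E (d.choose 2))
    (ψ : E d → ℂ) (A : E d → E d) : ℝ :=
  ∫ x in Ω, ((∑ j : Fin d, ‖covGrad Ω κ A ψ j x‖ ^ 2) + (1 / 2) * (‖ψ x‖ ^ 2 - 1) ^ 2
    + ‖curl Ω A x - H x‖ ^ 2 + divergence Ω A x ^ 2)

/-- `𝒦_τ(ψ, ψ', A, A') = ∫_Ω |(ψ - ψ')/τ|² + |(A - A')/τ|²`. -/
def dissipation (Ω : Set (E d)) (τ : ℝ) (ψ ψ' : E d → ℂ) (A A' : E d → E d) : ℝ :=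
  ∫ x in Ω, (‖(ψ x - ψ' x) / (τ : ℂ)‖ ^ 2 + ‖τ⁻¹ • (A x - A' x)‖ ^ 2)

/-! ### The generalized SAV scheme -/

/-- Weak form of
`η (ψ̄ - ψ)/τ + ((i/κ)∇ + A)² ψ̄ + |ψ|² ψ̄ - ψ = 0` with its natural boundary condition
`((i/κ)∇ψ̄ + Aψ̄) · n = 0`. Here `ψ`, `A` are the old values and `ψb` is the unknown `ψ̄`. -/
def SolvesOrderParameterEq (Ω : Set (E d)) (κ η τ : ℝ) (ψ : E d → ℂ) (A : E d → E d)
    (ψb : E d → ℂ) : Prop :=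
  MemMagH1 Ω A ψb ∧
    ∀ φ : E d → ℂ, MemMagH1 Ω A φ →
      ∫ x in Ω, ((η : ℂ) * ((ψb x - ψ x) / (τ : ℂ)) * star (φ x)
        + (∑ j : Fin d, covGrad Ω κ A ψb j x * star (covGrad Ω κ A φ j x))
        + (((‖ψ x‖ ^ 2 : ℝ) : ℂ) * ψb x - ψ x) * star (φ x)) = 0

/-- Weak form of
`(A' - A)/τ + curl curl A' - ∇(div A') + (i/2κ)(ψ̄* ∇ψ̄ - ψ̄ ∇ψ̄*) + |ψ̄|² A' = curl H`
with `A' · n = 0` and the natural boundary condition `curl A' × n = H × n`. Here `A` is the old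
value and `A'` is the unknown. -/
def SolvesPotentialEq (Ω : Set (E d)) (κ τ : ℝ) (H : E d → E (d.choose 2)) (A : E d → E d)
    (ψb : E d → ℂ) (A' : E d → E d) : Prop :=
  MemH1n Ω A' ∧ MemMagH1 Ω A' ψb ∧
    ∀ v : E d → E d, MemH1n Ω v → MemLp (fun x => ‖ψb x‖ • v x) 2 (volume.restrict Ω) →
      ∫ x in Ω, (inner ℝ (τ⁻¹ • (A' x - A x)) (v x)
        + inner ℝ (curl Ω A' x - H x) (curl Ω v x)
        + divergence Ω A' x * divergence Ω v x
        + (∑ j : Fin d, ((Complex.I / (2 * (κ : ℂ))) *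
            (star (ψb x) * weakPartial Ω j ψb x - ψb x * star (weakPartial Ω j ψb x))).re * v x j)
        + ‖ψb x‖ ^ 2 * inner ℝ (A' x) (v x)) = 0

/-- The sequences produced by the scheme: `ψ^n`, `ψ̄^n`, `A^n`, `r^n`, `r̃^n`, `ζ^n`, `α₀^n`,
`γ^n` (the barred and the last four are relevant for `n ≥ 1` only). -/
structure Iterates (d : ℕ) where
  ψ : ℕ → E d → ℂ
  ψbar : ℕ → E d → ℂ
  A : ℕ → E d → E d
  r : ℕ → ℝ
  rtilde : ℕ → ℝ
  ζ : ℕ → ℝ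
  α₀ : ℕ → ℝ
  γ : ℕ → ℝ

namespace Iterates

variable (s : Iterates d) (Ω : Set (E d)) (κ η τ : ℝ) (H : E d → E (d.choose 2))

/-- `ξ^n = 1 - (1 - ζ^n)²`. -/
def ξ (n : ℕ) : ℝ := 1 - (1 - s.ζ n) ^ 2

/-- `𝒢(ψ^n, A^n)`. -/
def G (n : ℕ) : ℝ := energy Ω κ H (s.ψ n) (s.A n)

/-- `𝒢(ψ̄^n, A^n)`. -/
def Gbar (n : ℕ) : ℝ := energy Ω κ H (s.ψbar n) (s.A n)

/-- `𝒦_τ(ψ^{n+1}, ψ^n, A^{n+1}, A^n)`, attached to the time level `n + 1`. -/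
def K (n : ℕ) : ℝ := dissipation Ω τ (s.ψ (n + 1)) (s.ψ n) (s.A (n + 1)) (s.A n)

/-- `𝒦_τ(ψ̄^{n+1}, ψ^n, A^{n+1}, A^n)`, attached to the time level `n + 1`. -/
def Kbar (n : ℕ) : ℝ := dissipation Ω τ (s.ψbar (n + 1)) (s.ψ n) (s.A (n + 1)) (s.A n)

/-- Case 1 at the time level `n + 1`. -/
def Case1 (n : ℕ) : Prop := s.rtilde (n + 1) = s.G Ω κ H (n + 1)

/-- Case 2 at the time level `n + 1`. -/
def Case2 (n : ℕ) : Prop := s.G Ω κ H (n + 1) < s.rtilde (n + 1)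

/-- Case 3 at the time level `n + 1`. -/
def Case3 (n : ℕ) : Prop :=
  s.rtilde (n + 1) < s.G Ω κ H (n + 1) ∧
    0 ≤ s.rtilde (n + 1) - s.G Ω κ H (n + 1)
      + τ * (s.rtilde (n + 1) / s.Gbar Ω κ H (n + 1)) * s.Kbar Ω τ n

/-- Case 4 at the time level `n + 1`. -/
def Case4 (n : ℕ) : Prop :=
  s.rtilde (n + 1) < s.G Ω κ H (n + 1) ∧
    s.rtilde (n + 1) - s.G Ω κ H (n + 1)
      + τ * (s.rtilde (n + 1) / s.Gbar Ω κ H (n + 1)) * s.Kbar Ω τ n < 0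

/-- The value of `γ^{n+1}` used in the cases 2 and 3. -/
def gammaFormula (n : ℕ) : ℝ :=
  (s.rtilde (n + 1) - s.G Ω κ H (n + 1)) / (τ * s.K Ω τ n)
    + s.rtilde (n + 1) * s.Kbar Ω τ n / (s.Gbar Ω κ H (n + 1) * s.K Ω τ n)

/-- The step of the scheme from the time level `n` to the time level `n + 1`. -/
structure IsStep (n : ℕ) : Prop where
  /-- Step 1: the equation for `ψ̄^{n+1}`. -/
  order_parameter : SolvesOrderParameterEq Ω κ η τ (s.ψ n) (s.A n) (s.ψbar (n + 1))
  /-- Step 1: the equation for `A^{n+1}`. -/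
  potential : SolvesPotentialEq Ω κ τ H (s.A n) (s.ψbar (n + 1)) (s.A (n + 1))
  /-- Step 1: the equation for `r̃^{n+1}`. -/
  rtilde_eq : (s.rtilde (n + 1) - s.r n) / τ
    = -(s.rtilde (n + 1) / s.Gbar Ω κ H (n + 1)) * s.Kbar Ω τ n
  /-- Step 2: `ζ^{n+1}`, truncated so that `|ξ^{n+1}| ≤ 1`. -/
  ζ_eq : s.ζ (n + 1) = min (s.rtilde (n + 1) / s.Gbar Ω κ H (n + 1)) (1 + √2)
  /-- Step 2: `ψ^{n+1} = ξ^{n+1} ψ̄^{n+1}`. -/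
  ψ_eq : s.ψ (n + 1) =ᵐ[volume.restrict Ω] fun x => (s.ξ (n + 1) : ℂ) * s.ψbar (n + 1) x
  /-- Step 3: the update of `r^{n+1}`. -/
  r_eq : s.r (n + 1)
    = s.α₀ (n + 1) * s.rtilde (n + 1) + (1 - s.α₀ (n + 1)) * s.G Ω κ H (n + 1)
  /-- The choice of `α₀^{n+1}` and `γ^{n+1}` in case 1. -/
  case1 : s.Case1 Ω κ H n → s.α₀ (n + 1) = 0 ∧
    s.γ (n + 1) = s.rtilde (n + 1) * s.Kbar Ω τ n / (s.Gbar Ω κ H (n + 1) * s.K Ω τ n)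
  /-- The choice of `α₀^{n+1}` and `γ^{n+1}` in case 2. -/
  case2 : s.Case2 Ω κ H n → s.α₀ (n + 1) = 0 ∧ s.γ (n + 1) = s.gammaFormula Ω κ τ H n
  /-- The choice of `α₀^{n+1}` and `γ^{n+1}` in case 3. -/
  case3 : s.Case3 Ω κ τ H n → s.α₀ (n + 1) = 0 ∧ s.γ (n + 1) = s.gammaFormula Ω κ τ H n
  /-- The choice of `α₀^{n+1}` and `γ^{n+1}` in case 4. -/
  case4 : s.Case4 Ω κ τ H n →
    s.α₀ (n + 1) = 1 - τ * s.rtilde (n + 1) * s.Kbar Ω τ n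
      / (s.Gbar Ω κ H (n + 1) * (s.G Ω κ H (n + 1) - s.rtilde (n + 1))) ∧
    s.γ (n + 1) = 0

/-- The sequences are produced by `M` steps of the scheme, started from `ψ⁰ = ψ₀ ∈ H¹(Ω; ℂ)`,
`A⁰ = A₀ ∈ H¹_n(Ω)` and `r⁰ = 𝒢(ψ⁰, A⁰)`. -/
structure IsScheme (M : ℕ) : Prop where
  ψ_zero : MemH1 Ω (s.ψ 0)
  A_zero : MemH1n Ω (s.A 0)
  r_zero : s.r 0 = s.G Ω κ H 0
  step : ∀ n < M, s.IsStep Ω κ η τ H n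

end Iterates

end GLSAV

end

/-! Everything rests on the invariant `0 ≤ r ≤ G`. The equation for `rtilde` makes the quantity
tested in cases 3 and 4 equal to (old `r`) - (new `G`). In cases 1–3 the new `r` is the new energy
and is at most the old `r`, hence at most the old energy; in case 4 the old `r` is kept and lies
below the new energy. This scalar argument (`r_eq_of_case`, `r_eq_of_case4`, `r_bounds`) gives the
second claim for every `τ`, without using the differential equations.

For `τ ≤ η` the differential equations enter. Testing the first one with a smooth radial truncation
of `ψbar` gives the maximum principle `‖ψbar‖ ≤ 1` (`SolvesOrderParameterEq.norm_le_one`); since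
`|ξ| ≤ 1`, the bound passes to the next `ψ`. Testing the two equations with the increments `ψbar -
ψ` and `A' - A`, convexity of squares and the two sup bounds yield decay of the energy before
rescaling (`energy_le_of_solves`), which is the claim in case 4.

For positivity, a vanishing `Gbar` would force both increments to vanish, and with them the old
energy (`energy_eq_zero_of_solves`), contradicting `0 < r ≤ G`. Rescaling by `ξ` cannot create a
zero energy either (`energy_eq_zero_of_const_mul`). The analytic input is the chain rule for weak
derivatives under C¹ maps with bounded derivative, proved by mollification. -/

noncomputable section

namespace GLSAV

open Filter Topology Convolution

/-! ### L¹ convergence of mollifications. -/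

section Mollification

variable {V F : Type*} [NormedAddCommGroup V] [NormedSpace ℝ V] [FiniteDimensional ℝ V]
  [MeasurableSpace V] [BorelSpace V] {μ : Measure V} [μ.IsAddHaarMeasure]
  [NormedAddCommGroup F] [NormedSpace ℝ F] [CompleteSpace F]

/-- Mollifications of an integrable function converge to it in `L¹`. -/
theorem tendsto_integral_norm_mollify_sub {ρ : ℕ → ContDiffBump (0 : V)} {K : ℝ}
    (hρ : Tendsto (fun k => (ρ k).rOut) atTop (𝓝 0)) (hK : ∀ k, (ρ k).rOut ≤ K * (ρ k).rIn)
    {f : V → F} (hf : Integrable f μ) :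
    Tendsto (fun k => ∫ x, ‖((ρ k).normed μ ⋆[ContinuousLinearMap.lsmul ℝ ℝ, μ] f) x - f x‖ ∂μ)
      atTop (𝓝 0) := by
  set m : ℕ → V → F := fun k => (ρ k).normed μ ⋆[ContinuousLinearMap.lsmul ℝ ℝ, μ] f with hm
  -- A Scheffé-type argument: `p k`, the mollification of `‖f‖`, dominates `‖m k‖` and has the same
  -- integral as `‖f‖`. It takes the place of an integrable majorant independent of `k`.
  set p : ℕ → V → ℝ := fun k =>
    (ρ k).normed μ ⋆[ContinuousLinearMap.lsmul ℝ ℝ, μ] (fun x => ‖f x‖) with hp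
  have hm_int (k) : Integrable (m k) μ := (ρ k).integrable_normed.integrable_convolution _ hf
  have hp_int (k) : Integrable (p k) μ := (ρ k).integrable_normed.integrable_convolution _ hf.norm
  have hp_eq (k) : ∫ x, p k x ∂μ = ∫ x, ‖f x‖ ∂μ := by
    simp only [hp]
    rw [integral_convolution _ (ρ k).integrable_normed hf.norm, (ρ k).integral_normed]
    simp
  have hmp (k x) : ‖m k x‖ ≤ p k x := by
    simp only [hm, hp, convolution]
    refine (norm_integral_le_integral_norm _).trans (le_of_eq ?_)
    congr 1
    ext t
    simp [norm_smul, abs_of_nonneg ((ρ k).nonneg_normed t)]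
  have hmlim : ∀ᵐ x ∂μ, Tendsto (fun k => m k x) atTop (𝓝 (f x)) :=
    ContDiffBump.ae_convolution_tendsto_right_of_locallyIntegrable hρ
      (Eventually.of_forall hK) hf.locallyIntegrable
  have hplim : ∀ᵐ x ∂μ, Tendsto (fun k => p k x) atTop (𝓝 ‖f x‖) :=
    ContDiffBump.ae_convolution_tendsto_right_of_locallyIntegrable hρ
      (Eventually.of_forall hK) hf.norm.locallyIntegrable
  have h1 : Tendsto (fun k => ∫ x, min ‖m k x - f x‖ (2 * ‖f x‖) ∂μ) atTop (𝓝 0) := by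
    rw [← integral_zero V ℝ (μ := μ)]
    refine tendsto_integral_of_dominated_convergence (fun x => 2 * ‖f x‖)
      (fun k => (((hm_int k).sub hf).norm.inf (hf.norm.const_mul 2)).aestronglyMeasurable)
      (hf.norm.const_mul 2) (fun k => ?_) ?_
    · filter_upwards with x
      rw [Real.norm_of_nonneg (by positivity)]
      exact min_le_right _ _
    · filter_upwards [hmlim] with x hx
      have : Tendsto (fun k => min ‖m k x - f x‖ (2 * ‖f x‖)) atTop
          (𝓝 (min ‖f x - f x‖ (2 * ‖f x‖))) := ((hx.sub_const _).norm).min tendsto_const_nhds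
      simpa using this
  have h2 : Tendsto (fun k => ∫ x, max (‖f x‖ - p k x) 0 ∂μ) atTop (𝓝 0) := by
    rw [show 𝓝 (0 : ℝ) = 𝓝 (∫ _, (0 : ℝ) ∂μ) by simp]
    refine tendsto_integral_of_dominated_convergence (fun x => ‖f x‖)
      (fun k => ((hf.norm.sub (hp_int k)).pos_part).aestronglyMeasurable)
      hf.norm (fun k => ?_) ?_
    · filter_upwards with x
      rw [Real.norm_of_nonneg (le_max_right _ _)]
      exact max_le (by linarith [(norm_nonneg _).trans (hmp k x)]) (norm_nonneg _)
    · filter_upwards [hplim] with x hx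
      have : Tendsto (fun k => max (‖f x‖ - p k x) 0) atTop (𝓝 (max (‖f x‖ - ‖f x‖) 0)) :=
        (tendsto_const_nhds.sub hx).max tendsto_const_nhds
      simpa using this
  refine squeeze_zero (fun k => integral_nonneg fun x => norm_nonneg _) (fun k => ?_)
    (by simpa using h1.add h2)
  have i1 : Integrable (fun x => min ‖m k x - f x‖ (2 * ‖f x‖)) μ :=
    ((hm_int k).sub hf).norm.inf (hf.norm.const_mul 2)
  have i2 : Integrable (fun x => max (‖f x‖ - p k x) 0) μ := (hf.norm.sub (hp_int k)).pos_part
  have i3 : Integrable (fun x => p k x - ‖f x‖) μ := (hp_int k).sub hf.norm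
  -- Since `‖m - f‖ ≤ p + ‖f‖`, whatever exceeds `2‖f‖` is at most the positive part of `p - ‖f‖`,
  -- written as `max (‖f‖ - p) 0 + (p - ‖f‖)`. The last term integrates to zero, and the other two
  -- are dominated by multiples of `‖f‖`.
  calc ∫ x, ‖m k x - f x‖ ∂μ
      ≤ ∫ x, (min ‖m k x - f x‖ (2 * ‖f x‖) + max (‖f x‖ - p k x) 0 + (p k x - ‖f x‖)) ∂μ := by
        refine integral_mono ((hm_int k).sub hf).norm ((i1.add i2).add i3) fun x => ?_
        have h := (norm_sub_le (m k x) (f x)).trans (add_le_add_left (hmp k x) _)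
        simp only
        rcases le_total ‖m k x - f x‖ (2 * ‖f x‖) with h' | h'
        · rw [min_eq_left h']
          linarith [le_max_left (‖f x‖ - p k x) 0]
        · rw [min_eq_right h']
          linarith [le_max_right (‖f x‖ - p k x) 0]
    _ = _ := by
        rw [integral_add (f := fun x => min ‖m k x - f x‖ (2 * ‖f x‖) + max (‖f x‖ - p k x) 0)
          (i1.add i2) i3, integral_add i1 i2, integral_sub (hp_int k) hf.norm, hp_eq k]
        ring

end Mollification

/-! ### Chain rule for weak derivatives. -/

section ChainRule

variable {d : ℕ} {F F' : Type*} [NormedAddCommGroup F] [NormedSpace ℝ F]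
  [NormedAddCommGroup F'] [NormedSpace ℝ F']

/-- Near the support of a test function the derivative of a mollification is the mollification
of the weak derivative. -/
theorem HasWeakPartial.fderiv_mollify [CompleteSpace F] {Ω : Set (E d)} (hΩ : IsOpen Ω)
    {j : Fin d} {u g : E d → F}
    (hu : IntegrableOn u Ω) (h : HasWeakPartial Ω j u g) (ρ : ContDiffBump (0 : E d)) {x : E d}
    (hx : Metric.closedBall x ρ.rOut ⊆ Ω) :
    fderiv ℝ (ρ.normed volume ⋆[ContinuousLinearMap.lsmul ℝ ℝ, volume] (Ω.indicator u)) x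
        (basisVec j)
      = (ρ.normed volume ⋆[ContinuousLinearMap.lsmul ℝ ℝ, volume] (Ω.indicator g)) x := by
  have hU : Integrable (Ω.indicator u) := (integrable_indicator_iff hΩ.measurableSet).2 hu
  have hD := ρ.hasCompactSupport_normed.hasFDerivAt_convolution_left
    (ContinuousLinearMap.lsmul ℝ ℝ) (ρ.contDiff_normed (μ := volume) (n := 1)) hU.locallyIntegrable x
  rw [hD.fderiv]
  have hce : ConvolutionExistsAt (fderiv ℝ (ρ.normed volume)) (Ω.indicator u) x
      (ContinuousLinearMap.precompL (E d) (ContinuousLinearMap.lsmul ℝ ℝ)) volume :=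
    (ρ.hasCompactSupport_normed.fderiv ℝ).convolutionExists_left _
      (ρ.contDiff_normed (μ := volume) (n := 1)|>.continuous_fderiv one_ne_zero)
      hU.locallyIntegrable x
  have h1 : ((fderiv ℝ (ρ.normed volume)
      ⋆[ContinuousLinearMap.precompL (E d) (ContinuousLinearMap.lsmul ℝ ℝ), volume]
        (Ω.indicator u)) x) (basisVec j)
      = ∫ t, (fderiv ℝ (ρ.normed volume) t (basisVec j)) • Ω.indicator u (x - t) := by
    simp only [convolution]
    rw [ContinuousLinearMap.integral_apply hce]
    rfl
  rw [h1]
  -- The reflected, translated bump is an admissible test function because its support lies in the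
  -- closed ball around `x`, hence in `Ω`.
  have h2 := h (fun y => ρ.normed volume (x - y)) (by
    exact (ρ.contDiff_normed).comp (contDiff_const.sub contDiff_id)) ?_ ?_
  · have hfd (y) : fderiv ℝ (fun y => ρ.normed volume (x - y)) y (basisVec j)
        = - fderiv ℝ (ρ.normed volume) (x - y) (basisVec j) := by
      have hd : HasFDerivAt (ρ.normed volume) (fderiv ℝ (ρ.normed volume) (x - y)) (x - y) :=
        ((ρ.contDiff_normed (μ := volume) (n := 1)).differentiable one_ne_zero _).hasFDerivAt
      have hd' : HasFDerivAt (fun y => ρ.normed volume (x - y)) _ y :=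
        hd.comp y ((hasFDerivAt_id y).const_sub x)
      rw [hd'.fderiv]
      simp
    simp only [hfd, neg_smul, integral_neg, neg_inj] at h2
    rw [← integral_sub_left_eq_self _ volume x]
    simp only [sub_sub_cancel]
    simp only [convolution_eq_swap, ContinuousLinearMap.lsmul_apply]
    rw [← integral_indicator hΩ.measurableSet, ← integral_indicator hΩ.measurableSet] at h2
    refine Eq.trans (integral_congr_ae (.of_forall fun y => ?_))
      (h2.trans (integral_congr_ae (.of_forall fun y => ?_)))
    · by_cases hy : y ∈ Ω <;> simp [hy]
    · by_cases hy : y ∈ Ω <;> simp [hy]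
  · refine HasCompactSupport.of_support_subset_isCompact (isCompact_closedBall x ρ.rOut) ?_
    intro y hy
    have : x - y ∈ Function.support (ρ.normed volume) := hy
    rw [ρ.support_normed_eq] at this
    rw [mem_ball_zero_iff] at this
    rw [Metric.mem_closedBall', dist_eq_norm]
    exact this.le
  · refine (closure_minimal ?_ Metric.isClosed_closedBall).trans hx
    intro y hy
    have : x - y ∈ Function.support (ρ.normed volume) := hy
    rw [ρ.support_normed_eq] at this
    rw [mem_ball_zero_iff] at this
    rw [Metric.mem_closedBall', dist_eq_norm]
    exact this.le

/-- The chain rule for weak derivatives and continuously differentiable maps with bounded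
derivative. -/
theorem HasWeakPartial.comp_contDiff [CompleteSpace F] [CompleteSpace F'] {Ω : Set (E d)}
    (hΩ : IsOpen Ω) {j : Fin d} {u g : E d → F} (hu : IntegrableOn u Ω) (hg : IntegrableOn g Ω)
    (h : HasWeakPartial Ω j u g) {Φ : F → F'} (hΦ : ContDiff ℝ 1 Φ) {C : ℝ}
    (hC : ∀ z, ‖fderiv ℝ Φ z‖ ≤ C) :
    HasWeakPartial Ω j (fun x => Φ (u x)) (fun x => fderiv ℝ Φ (u x) (g x)) := by
  intro φ hφ hφc hφΩ
  have hC0 : 0 ≤ C := (norm_nonneg _).trans (hC 0)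
  have hLip (x y : F) : ‖Φ x - Φ y‖ ≤ C * ‖x - y‖ :=
    Convex.norm_image_sub_le_of_norm_fderiv_le
      (fun z _ => hΦ.differentiable one_ne_zero z) (fun z _ => hC z) convex_univ
      (Set.mem_univ y) (Set.mem_univ x)
  -- With radii at most `δ`, mollification at points of the support of `φ` only sees values inside
  -- `Ω`, so `fderiv_mollify` applies there.
  obtain ⟨δ, hδ, hδΩ⟩ := hφc.isCompact.exists_cthickening_subset_open hΩ hφΩ
  set φ' : E d → ℝ := fun x => fderiv ℝ φ x (basisVec j) with hφ'
  have hφ'_cont : Continuous φ' :=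
    (hφ.continuous_fderiv (by simp)).clm_apply continuous_const
  have hφ'_supp : tsupport φ' ⊆ tsupport φ := tsupport_fderiv_apply_subset ℝ _
  have hφ'_c : HasCompactSupport φ' := hφc.of_isClosed_subset (isClosed_tsupport _) hφ'_supp
  obtain ⟨B, hB⟩ := hφc.exists_bound_of_continuous hφ.continuous
  obtain ⟨B', hB'⟩ := hφ'_c.exists_bound_of_continuous hφ'_cont
  have hB0 : 0 ≤ B := (norm_nonneg _).trans (hB 0)
  have hB'0 : 0 ≤ B' := (norm_nonneg _).trans (hB' 0)
  set U := Ω.indicator u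
  set V := Ω.indicator g
  have hU : Integrable U := (integrable_indicator_iff hΩ.measurableSet).2 hu
  have hV : Integrable V := (integrable_indicator_iff hΩ.measurableSet).2 hg
  -- The fixed ratio 2 of outer to inner radius is what the almost everywhere convergence of
  -- mollifications requires.
  let ρ : ℕ → ContDiffBump (0 : E d) := fun k =>
    { rIn := δ / (k + 1) / 2
      rOut := δ / (k + 1)
      rIn_pos := by positivity
      rIn_lt_rOut := half_lt_self (by positivity) }
  have hρ : Tendsto (fun k => (ρ k).rOut) atTop (𝓝 0) :=
    tendsto_const_div_atTop_nhds_zero_nat δ |>.comp (tendsto_add_atTop_nat 1) |>.congr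
      fun k => by simp [ρ]
  have hρK (k) : (ρ k).rOut ≤ 2 * (ρ k).rIn := by simp only [ρ]; linarith
  have hρδ (k) : (ρ k).rOut ≤ δ := div_le_self hδ.le (by simp)
  set m : ℕ → E d → F := fun k =>
    (ρ k).normed volume ⋆[ContinuousLinearMap.lsmul ℝ ℝ, volume] U with hm
  set v : ℕ → E d → F := fun k =>
    (ρ k).normed volume ⋆[ContinuousLinearMap.lsmul ℝ ℝ, volume] V with hv
  have hm_diff (k) : ContDiff ℝ 1 (m k) :=
    (ρ k).hasCompactSupport_normed.contDiff_convolution_left _ (ρ k).contDiff_normed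
      hU.locallyIntegrable
  have hm_int (k) : Integrable (m k) := (ρ k).integrable_normed.integrable_convolution _ hU
  have hv_int (k) : Integrable (v k) := (ρ k).integrable_normed.integrable_convolution _ hV
  have hmlim : ∀ᵐ x, Tendsto (fun k => m k x) atTop (𝓝 (U x)) :=
    ContDiffBump.ae_convolution_tendsto_right_of_locallyIntegrable hρ
      (Eventually.of_forall hρK) hU.locallyIntegrable
  have hmL := tendsto_integral_norm_mollify_sub hρ hρK hU
  have hvL := tendsto_integral_norm_mollify_sub hρ hρK hV
  have hDΦ : Continuous (fderiv ℝ Φ) := hΦ.continuous_fderiv one_ne_zero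
  have hΦint {w : E d → F} (hw : Integrable w) : Integrable (fun x => φ' x • Φ (w x)) := by
    refine Integrable.mono' (g := fun x => ‖φ' x‖ * ‖Φ 0‖ + B' * (C * ‖w x‖))
      (((hφ'_cont.integrable_of_hasCompactSupport hφ'_c).norm.mul_const _).add
        ((hw.norm.const_mul _).const_mul _))
      (hφ'_cont.aestronglyMeasurable.smul
        (hΦ.continuous.comp_aestronglyMeasurable hw.aestronglyMeasurable)) (.of_forall fun x => ?_)
    rw [norm_smul]
    have h1 : ‖Φ (w x)‖ ≤ ‖Φ 0‖ + C * ‖w x‖ := by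
      have := hLip (w x) 0
      rw [sub_zero] at this
      linarith [norm_le_norm_add_norm_sub' (Φ (w x)) (Φ 0)]
    calc ‖φ' x‖ * ‖Φ (w x)‖ ≤ ‖φ' x‖ * (‖Φ 0‖ + C * ‖w x‖) := by gcongr
      _ = ‖φ' x‖ * ‖Φ 0‖ + ‖φ' x‖ * (C * ‖w x‖) := by ring
      _ ≤ _ := by gcongr; exact hB' x
  have hDbd (w z : F) (x) : ‖φ x • fderiv ℝ Φ w z‖ ≤ B * (C * ‖z‖) := by
    rw [norm_smul]
    gcongr
    · exact hB x
    · exact (ContinuousLinearMap.le_opNorm _ _).trans (by gcongr; exact hC w)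
  have hDmeas {w z : E d → F} (hw : Integrable w) (hz : Integrable z) :
      AEStronglyMeasurable (fun x => φ x • fderiv ℝ Φ (w x) (z x)) volume :=
    hφ.continuous.aestronglyMeasurable.smul
      (isBoundedBilinearMap_apply.continuous.comp_aestronglyMeasurable
        ((hDΦ.comp_aestronglyMeasurable hw.aestronglyMeasurable).prodMk hz.aestronglyMeasurable))
  have hDint {w z : E d → F} (hw : Integrable w) (hz : Integrable z) :
      Integrable (fun x => φ x • fderiv ℝ Φ (w x) (z x)) :=
    Integrable.mono' ((hz.norm.const_mul C).const_mul B) (hDmeas hw hz)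
      (.of_forall fun x => hDbd _ _ _)
  have key (k) : ∫ x, φ' x • Φ (m k x) = - ∫ x, φ x • fderiv ℝ Φ (m k x) (v k x) := by
    have hfd (x) : fderiv ℝ (fun x => Φ (m k x)) x (basisVec j)
        = fderiv ℝ Φ (m k x) (fderiv ℝ (m k) x (basisVec j)) := by
      have : HasFDerivAt (fun x => Φ (m k x)) _ x :=
        (hΦ.differentiable one_ne_zero (m k x)).hasFDerivAt.comp x
          ((hm_diff k).differentiable one_ne_zero x).hasFDerivAt
      rw [this.fderiv]
      rfl
    have heq (x) : φ x • fderiv ℝ (fun x => Φ (m k x)) x (basisVec j)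
        = φ x • fderiv ℝ Φ (m k x) (v k x) := by
      by_cases hx : x ∈ tsupport φ
      · rw [hfd, HasWeakPartial.fderiv_mollify hΩ hu h]
        exact (Metric.closedBall_subset_closedBall (hρδ k)).trans
          ((Metric.closedBall_subset_cthickening hx δ).trans hδΩ)
      · simp [image_eq_zero_of_notMem_tsupport hx]
    have hibp := integral_smul_fderiv_eq_neg_fderiv_smul_of_integrable (μ := volume) (f := φ)
      (g := fun x => Φ (m k x)) (v := basisVec j) (hΦint (hm_int k))
      (by simpa only [heq] using hDint (hm_int k) (hv_int k))
      ((hφ.continuous.smul (hΦ.continuous.comp (hm_diff k).continuous)).integrable_of_hasCompactSupport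
        hφc.smul_right)
      (fun x _ => hφ.differentiable (by simp) x)
      (fun x _ => ((hΦ.comp (hm_diff k)).differentiable one_ne_zero) x)
    simp only [heq] at hibp
    rw [hibp, neg_neg]
  have lim1 : Tendsto (fun k => ∫ x, φ' x • Φ (m k x)) atTop (𝓝 (∫ x, φ' x • Φ (U x))) := by
    rw [tendsto_iff_norm_sub_tendsto_zero]
    refine squeeze_zero (fun k => norm_nonneg _) (fun k => ?_)
      (by simpa using hmL.const_mul (B' * C))
    rw [← integral_sub (hΦint (hm_int k)) (hΦint hU), ← integral_const_mul]
    refine (norm_integral_le_integral_norm _).trans (integral_mono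
      ((hΦint (hm_int k)).sub (hΦint hU)).norm (((hm_int k).sub hU).norm.const_mul _) fun x => ?_)
    simp only
    rw [← smul_sub, norm_smul, mul_assoc]
    gcongr
    · exact hB' x
    · exact hLip _ _
  have lim2 : Tendsto (fun k => ∫ x, φ x • fderiv ℝ Φ (m k x) (v k x)) atTop
      (𝓝 (∫ x, φ x • fderiv ℝ Φ (U x) (V x))) := by
    -- The derivative of `Φ` is merely continuous and bounded: boundedness and L¹ convergence of `v
    -- k` handle the first term, continuity and dominated convergence with `V` fixed the second.
    have e (k) : ∫ x, φ x • fderiv ℝ Φ (m k x) (v k x)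
        = (∫ x, φ x • fderiv ℝ Φ (m k x) (v k x - V x)) + ∫ x, φ x • fderiv ℝ Φ (m k x) (V x) := by
      refine Eq.trans (integral_congr_ae (.of_forall fun x => ?_))
        (integral_add (hDint (hm_int k) ((hv_int k).sub hV)) (hDint (hm_int k) hV))
      simp [smul_sub]
    simp only [e]
    rw [← zero_add (∫ x, φ x • fderiv ℝ Φ (U x) (V x))]
    refine Tendsto.add ?_ ?_
    · refine squeeze_zero_norm (fun k => ?_) (by simpa using hvL.const_mul (B * C))
      rw [← integral_const_mul]
      refine (norm_integral_le_integral_norm _).trans (integral_mono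
        (hDint (hm_int k) ((hv_int k).sub hV)).norm (((hv_int k).sub hV).norm.const_mul _)
        fun x => ?_)
      simp only
      rw [mul_assoc]
      exact hDbd _ _ _
    · refine tendsto_integral_of_dominated_convergence (fun x => B * (C * ‖V x‖))
        (fun k => hDmeas (hm_int k) hV) ((hV.norm.const_mul C).const_mul B)
        (fun k => .of_forall fun x => hDbd _ _ _) ?_
      filter_upwards [hmlim] with x hx
      exact (((isBoundedBilinearMap_apply.continuous.comp
        (hDΦ.prodMk continuous_const)).tendsto (U x)).comp hx).const_smul _
  have hlim := tendsto_nhds_unique (lim1.congr key) lim2.neg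
  have c1 : ∫ x in Ω, φ' x • Φ (u x) = ∫ x, φ' x • Φ (U x) := by
    rw [← integral_indicator hΩ.measurableSet]
    refine integral_congr_ae (.of_forall fun x => ?_)
    by_cases hx : x ∈ Ω
    · simp [hx, U]
    · simp [hx, image_eq_zero_of_notMem_tsupport fun hx' => hx (hφΩ (hφ'_supp hx'))]
  have c2 : ∫ x in Ω, φ x • fderiv ℝ Φ (u x) (g x) = ∫ x, φ x • fderiv ℝ Φ (U x) (V x) := by
    rw [← integral_indicator hΩ.measurableSet]
    refine integral_congr_ae (.of_forall fun x => ?_)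
    by_cases hx : x ∈ Ω
    · simp [hx, U, V]
    · simp [hx, V]
  rw [c1, c2, hlim]

end ChainRule

/-! ### Calculus of weak derivatives in H¹. -/

section SobolevCalculus

variable {d : ℕ} {F F' : Type*} [NormedAddCommGroup F] [NormedSpace ℝ F]
  [NormedAddCommGroup F'] [NormedSpace ℝ F'] {Ω : Set (E d)} {j : Fin d}

theorem integrableOn_smul_of_hasCompactSupport {φ : E d → ℝ} (hφ : Continuous φ)
    (hφc : HasCompactSupport φ) {u : E d → F} (hu : IntegrableOn u Ω) :
    IntegrableOn (fun x => φ x • u x) Ω := by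
  obtain ⟨B, hB⟩ := hφc.exists_bound_of_continuous hφ
  exact Integrable.bdd_smul hu B hφ.aestronglyMeasurable (.of_forall hB)

theorem continuous_fderiv_apply {φ : E d → ℝ} (hφ : ContDiff ℝ (⊤ : ℕ∞) φ) (v : E d) :
    Continuous fun x => fderiv ℝ φ x v :=
  (hφ.continuous_fderiv (by simp)).clm_apply continuous_const

theorem _root_.HasCompactSupport.fderiv_apply' {φ : E d → ℝ} (hφ : HasCompactSupport φ) (v : E d) :
    HasCompactSupport fun x => fderiv ℝ φ x v :=
  hφ.of_isClosed_subset (isClosed_tsupport _) (tsupport_fderiv_apply_subset ℝ v)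

theorem HasWeakPartial.sub {u u' g g' : E d → F} (h : HasWeakPartial Ω j u g)
    (h' : HasWeakPartial Ω j u' g') (hu : IntegrableOn u Ω) (hu' : IntegrableOn u' Ω)
    (hg : IntegrableOn g Ω) (hg' : IntegrableOn g' Ω) :
    HasWeakPartial Ω j (fun x => u x - u' x) (fun x => g x - g' x) := by
  intro φ hφ hφc hφΩ
  have hc := continuous_fderiv_apply hφ (basisVec j)
  have hs := hφc.fderiv_apply' (basisVec j)
  simp only [smul_sub]
  rw [integral_sub (integrableOn_smul_of_hasCompactSupport hc hs hu)
      (integrableOn_smul_of_hasCompactSupport hc hs hu'),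
    integral_sub (integrableOn_smul_of_hasCompactSupport hφ.continuous hφc hg)
      (integrableOn_smul_of_hasCompactSupport hφ.continuous hφc hg'),
    h φ hφ hφc hφΩ, h' φ hφ hφc hφΩ]
  abel

theorem HasWeakPartial.congr {u u' g : E d → F} (h : HasWeakPartial Ω j u g)
    (hu : u =ᵐ[volume.restrict Ω] u') : HasWeakPartial Ω j u' g := by
  intro φ hφ hφc hφΩ
  rw [← h φ hφ hφc hφΩ]
  refine integral_congr_ae ?_
  filter_upwards [hu] with x hx
  rw [hx]

theorem HasWeakPartial.ae_eq [CompleteSpace F] (hΩ : IsOpen Ω) {u g g' : E d → F}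
    (h : HasWeakPartial Ω j u g) (h' : HasWeakPartial Ω j u g') (hg : IntegrableOn g Ω)
    (hg' : IntegrableOn g' Ω) : g =ᵐ[volume.restrict Ω] g' := by
  have := hΩ.ae_eq_zero_of_integral_contDiff_smul_eq_zero (μ := volume)
    (f := fun x => g x - g' x) (hg.sub hg').locallyIntegrableOn fun φ hφ hφc hφΩ => by
      have e : ∫ x, φ x • (g x - g' x) = ∫ x in Ω, φ x • (g x - g' x) := by
        refine (setIntegral_eq_integral_of_forall_compl_eq_zero fun x hx => ?_).symm
        simp [image_eq_zero_of_notMem_tsupport fun hx' => hx (hφΩ hx')]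
      rw [e]
      simp only [smul_sub]
      rw [integral_sub (integrableOn_smul_of_hasCompactSupport hφ.continuous hφc hg)
        (integrableOn_smul_of_hasCompactSupport hφ.continuous hφc hg'), sub_eq_zero]
      have e1 := h φ hφ hφc hφΩ
      rw [h' φ hφ hφc hφΩ] at e1
      exact (neg_injective e1).symm
  rw [EventuallyEq, ae_restrict_iff' hΩ.measurableSet]
  filter_upwards [this] with x hx hxΩ
  exact sub_eq_zero.1 (hx hxΩ)

theorem integrableOn_of_memLp_two {F : Type*} [NormedAddCommGroup F]
    [IsFiniteMeasure ((volume : Measure (E d)).restrict Ω)] {u : E d → F} (hu : MemLp u 2 (volume.restrict Ω)) :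
    IntegrableOn u Ω :=
  hu.integrable one_le_two

theorem MemH1.memLp_weakPartial {u : E d → F} (hu : MemH1 Ω u) (j : Fin d) :
    MemLp (weakPartial Ω j u) 2 (volume.restrict Ω) := by
  rw [weakPartial, dif_pos (hu.2 j)]
  exact (hu.2 j).choose_spec.1

theorem MemH1.hasWeakPartial {u : E d → F} (hu : MemH1 Ω u) (j : Fin d) :
    HasWeakPartial Ω j u (weakPartial Ω j u) := by
  rw [weakPartial, dif_pos (hu.2 j)]
  exact (hu.2 j).choose_spec.2

/-- The equality is literal, not merely almost everywhere: both sides choose from the same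
predicate, which does not see null sets. -/
theorem weakPartial_congr {u u' : E d → F} (hu : u =ᵐ[volume.restrict Ω] u') :
    weakPartial Ω j u = weakPartial Ω j u' := by
  have : ∀ g, HasWeakPartial Ω j u g = HasWeakPartial Ω j u' g := fun g =>
    propext ⟨fun h => h.congr hu, fun h => h.congr hu.symm⟩
  unfold weakPartial
  rw [show HasWeakPartial Ω j u = HasWeakPartial Ω j u' from funext this]

theorem MemH1.congr {u u' : E d → F} (h : MemH1 Ω u) (hu : u =ᵐ[volume.restrict Ω] u') :
    MemH1 Ω u' :=
  ⟨h.1.ae_eq hu, fun j => ⟨_, h.memLp_weakPartial j, (h.hasWeakPartial j).congr hu⟩⟩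

theorem memLp_fderiv_apply {u g : E d → F} (hu : MemLp u 2 (volume.restrict Ω))
    (hg : MemLp g 2 (volume.restrict Ω)) {Φ : F → F'} (hΦ : ContDiff ℝ 1 Φ) {C : ℝ}
    (hC : ∀ z, ‖fderiv ℝ Φ z‖ ≤ C) :
    MemLp (fun x => fderiv ℝ Φ (u x) (g x)) 2 (volume.restrict Ω) := by
  refine MemLp.of_le_mul (c := C) hg (isBoundedBilinearMap_apply.continuous.comp_aestronglyMeasurable
    (((hΦ.continuous_fderiv one_ne_zero).comp_aestronglyMeasurable
      hu.aestronglyMeasurable).prodMk hg.aestronglyMeasurable)) (.of_forall fun x => ?_)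
  exact (ContinuousLinearMap.le_opNorm _ _).trans (by gcongr; exact hC _)

variable [IsFiniteMeasure ((volume : Measure (E d)).restrict Ω)]

theorem HasWeakPartial.weakPartial_ae_eq [CompleteSpace F] (hΩ : IsOpen Ω) {u g : E d → F}
    (h : HasWeakPartial Ω j u g) (hg : MemLp g 2 (volume.restrict Ω)) :
    weakPartial Ω j u =ᵐ[volume.restrict Ω] g := by
  have hex : ∃ g : E d → F, MemLp g 2 (volume.restrict Ω) ∧ HasWeakPartial Ω j u g := ⟨g, hg, h⟩
  rw [weakPartial, dif_pos hex]
  exact HasWeakPartial.ae_eq hΩ hex.choose_spec.2 h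
    (integrableOn_of_memLp_two hex.choose_spec.1) (integrableOn_of_memLp_two hg)

theorem MemH1.hasWeakPartial_sub {u u' : E d → F} (h : MemH1 Ω u) (h' : MemH1 Ω u') (j : Fin d) :
    HasWeakPartial Ω j (fun x => u x - u' x)
      (fun x => weakPartial Ω j u x - weakPartial Ω j u' x) :=
  (h.hasWeakPartial j).sub (h'.hasWeakPartial j) (integrableOn_of_memLp_two h.1)
    (integrableOn_of_memLp_two h'.1) (integrableOn_of_memLp_two (h.memLp_weakPartial j))
    (integrableOn_of_memLp_two (h'.memLp_weakPartial j))

theorem MemH1.sub {u u' : E d → F} (h : MemH1 Ω u) (h' : MemH1 Ω u') :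
    MemH1 Ω (fun x => u x - u' x) :=
  ⟨h.1.sub h'.1, fun j => ⟨_, (h.memLp_weakPartial j).sub (h'.memLp_weakPartial j),
    h.hasWeakPartial_sub h' j⟩⟩

theorem weakPartial_sub_ae_eq [CompleteSpace F] (hΩ : IsOpen Ω) {u u' : E d → F}
    (h : MemH1 Ω u) (h' : MemH1 Ω u') (j : Fin d) :
    weakPartial Ω j (fun x => u x - u' x) =ᵐ[volume.restrict Ω]
      fun x => weakPartial Ω j u x - weakPartial Ω j u' x :=
  (h.hasWeakPartial_sub h' j).weakPartial_ae_eq hΩ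
    ((h.memLp_weakPartial j).sub (h'.memLp_weakPartial j))

theorem MemH1.hasWeakPartial_comp [CompleteSpace F] [CompleteSpace F'] (hΩ : IsOpen Ω)
    {u : E d → F} (h : MemH1 Ω u) {Φ : F → F'} (hΦ : ContDiff ℝ 1 Φ) {C : ℝ}
    (hC : ∀ z, ‖fderiv ℝ Φ z‖ ≤ C) (j : Fin d) :
    HasWeakPartial Ω j (fun x => Φ (u x)) (fun x => fderiv ℝ Φ (u x) (weakPartial Ω j u x)) :=
  (h.hasWeakPartial j).comp_contDiff hΩ (integrableOn_of_memLp_two h.1)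
    (integrableOn_of_memLp_two (h.memLp_weakPartial j)) hΦ hC

theorem MemH1.comp_contDiff [CompleteSpace F] [CompleteSpace F'] (hΩ : IsOpen Ω)
    {u : E d → F} (h : MemH1 Ω u) {Φ : F → F'} (hΦ : ContDiff ℝ 1 Φ) (h0 : Φ 0 = 0) {C : ℝ}
    (hC : ∀ z, ‖fderiv ℝ Φ z‖ ≤ C) : MemH1 Ω (fun x => Φ (u x)) := by
  refine ⟨?_, fun j => ⟨_, memLp_fderiv_apply h.1 (h.memLp_weakPartial j) hΦ hC,
    h.hasWeakPartial_comp hΩ hΦ hC j⟩⟩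
  refine MemLp.of_le_mul (c := C) h.1
    (hΦ.continuous.comp_aestronglyMeasurable h.1.aestronglyMeasurable) (.of_forall fun x => ?_)
  simpa [h0] using Convex.norm_image_sub_le_of_norm_fderiv_le
      (fun z _ => hΦ.differentiable one_ne_zero z) (fun z _ => hC z) convex_univ
      (Set.mem_univ 0) (Set.mem_univ (u x))

theorem weakPartial_comp_ae_eq [CompleteSpace F] [CompleteSpace F'] (hΩ : IsOpen Ω)
    {u : E d → F} (h : MemH1 Ω u) {Φ : F → F'} (hΦ : ContDiff ℝ 1 Φ) {C : ℝ}
    (hC : ∀ z, ‖fderiv ℝ Φ z‖ ≤ C) (j : Fin d) :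
    weakPartial Ω j (fun x => Φ (u x)) =ᵐ[volume.restrict Ω]
      fun x => fderiv ℝ Φ (u x) (weakPartial Ω j u x) :=
  (h.hasWeakPartial_comp hΩ hΦ hC j).weakPartial_ae_eq hΩ
    (memLp_fderiv_apply h.1 (h.memLp_weakPartial j) hΦ hC)

theorem MemH1.const_mul (hΩ : IsOpen Ω) {u : E d → ℂ} (h : MemH1 Ω u) (c : ℂ) :
    MemH1 Ω (fun x => c * u x) := by
  have := h.comp_contDiff hΩ (Φ := ContinuousLinearMap.mul ℝ ℂ c)
    (ContinuousLinearMap.contDiff _) (map_zero _) (C := ‖ContinuousLinearMap.mul ℝ ℂ c‖)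
    (fun z => by rw [ContinuousLinearMap.fderiv])
  exact this

theorem weakPartial_const_mul_ae_eq (hΩ : IsOpen Ω) {u : E d → ℂ} (h : MemH1 Ω u) (c : ℂ)
    (j : Fin d) :
    weakPartial Ω j (fun x => c * u x) =ᵐ[volume.restrict Ω] fun x => c * weakPartial Ω j u x := by
  have := weakPartial_comp_ae_eq hΩ h (Φ := ContinuousLinearMap.mul ℝ ℂ c)
    (ContinuousLinearMap.contDiff _) (C := ‖ContinuousLinearMap.mul ℝ ℂ c‖)
    (fun z => by rw [ContinuousLinearMap.fderiv]) j
  simp only [ContinuousLinearMap.fderiv] at this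
  exact this

end SobolevCalculus

/-! ### Curl, divergence, normal trace and covariant gradient. -/

section VectorFields

variable {d : ℕ} {Ω : Set (E d)}

theorem curlOfJacobian_add : ∀ (d : ℕ) (J J' : Fin d → Fin d → ℝ),
    curlOfJacobian d (J + J') = curlOfJacobian d J + curlOfJacobian d J'
  | 0, _, _ => (zero_add _).symm
  | 1, _, _ => (zero_add _).symm
  | 2, J, J' => by
    ext i
    simp only [curlOfJacobian, Pi.add_apply, PiLp.add_apply]
    ring
  | 3, J, J' => by
    ext i
    change Fin 3 at i
    fin_cases i
    · exact add_sub_add_comm (J 2 1) (J' 2 1) (J 1 2) (J' 1 2)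
    · exact add_sub_add_comm (J 0 2) (J' 0 2) (J 2 0) (J' 2 0)
    · exact add_sub_add_comm (J 1 0) (J' 1 0) (J 0 1) (J' 0 1)
  | n + 4, _, _ => (zero_add _).symm

theorem curlOfJacobian_smul : ∀ (d : ℕ) (c : ℝ) (J : Fin d → Fin d → ℝ),
    curlOfJacobian d (c • J) = c • curlOfJacobian d J
  | 0, _, _ => (smul_zero _).symm
  | 1, _, _ => (smul_zero _).symm
  | 2, c, J => by
    ext i
    simp only [curlOfJacobian, Pi.smul_apply, PiLp.smul_apply, smul_eq_mul]
    ring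
  | 3, c, J => by
    ext i
    change Fin 3 at i
    fin_cases i
    · exact (mul_sub c (J 2 1) (J 1 2)).symm
    · exact (mul_sub c (J 0 2) (J 2 0)).symm
    · exact (mul_sub c (J 1 0) (J 0 1)).symm
  | n + 4, _, _ => (smul_zero _).symm

/-- The curl as a linear function of the Jacobian. -/
def curlLinear (d : ℕ) : (Fin d → Fin d → ℝ) →ₗ[ℝ] E (d.choose 2) where
  toFun := curlOfJacobian d
  map_add' := curlOfJacobian_add d
  map_smul' := curlOfJacobian_smul d

theorem curlOfJacobian_sub (J J' : Fin d → Fin d → ℝ) :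
    curlOfJacobian d (J - J') = curlOfJacobian d J - curlOfJacobian d J' :=
  (curlLinear d).map_sub J J'

theorem MemH1.memLp_curl {A : E d → E d} (h : MemH1 Ω A) :
    MemLp (curl Ω A) 2 (volume.restrict Ω) := by
  have hJ : MemLp (fun x (i j : Fin d) => (weakPartial Ω j A x) i) 2 (volume.restrict Ω) :=
    MemLp.of_eval fun i => MemLp.of_eval fun j => (h.memLp_weakPartial j).eval_piLp i
  exact (LinearMap.toContinuousLinearMap (curlLinear d)).comp_memLp' hJ

theorem MemH1.memLp_divergence {A : E d → E d} (h : MemH1 Ω A) :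
    MemLp (divergence Ω A) 2 (volume.restrict Ω) :=
  memLp_finsetSum (f := fun (i : Fin d) x => (weakPartial Ω i A x) i) _
    fun i _ => (h.memLp_weakPartial i).eval_piLp i

theorem MemMagH1.congr {A : E d → E d} {ψ ψ' : E d → ℂ} (h : MemMagH1 Ω A ψ)
    (hψ : ψ =ᵐ[volume.restrict Ω] ψ') : MemMagH1 Ω A ψ' := by
  refine ⟨h.1.congr hψ, h.2.1.ae_eq hψ, h.2.2.ae_eq ?_⟩
  filter_upwards [hψ] with x hx
  rw [hx]

theorem MemMagH1.memLp_covGrad {A : E d → E d} (hA : MemH1 Ω A) {ψ : E d → ℂ}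
    (h : MemMagH1 Ω A ψ) (κ : ℝ) (j : Fin d) :
    MemLp (covGrad Ω κ A ψ j) 2 (volume.restrict Ω) := by
  refine MemLp.add ((h.1.memLp_weakPartial j).const_mul _) (h.2.2.of_le
    ((Complex.continuous_ofReal.comp_aestronglyMeasurable
      (hA.1.eval_piLp j).aestronglyMeasurable).mul h.1.1.aestronglyMeasurable)
    (.of_forall fun x => ?_))
  simp only [norm_mul, norm_smul, norm_norm, Complex.norm_real]
  rw [mul_comm]
  gcongr
  exact PiLp.norm_apply_le (A x) j

variable [IsFiniteMeasure ((volume : Measure (E d)).restrict Ω)]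

theorem curl_sub_ae_eq (hΩ : IsOpen Ω) {A A' : E d → E d} (h : MemH1 Ω A) (h' : MemH1 Ω A') :
    curl Ω (fun x => A x - A' x) =ᵐ[volume.restrict Ω] fun x => curl Ω A x - curl Ω A' x := by
  filter_upwards [eventually_all.2 fun j => weakPartial_sub_ae_eq hΩ h h' j] with x hx
  simp only [curl, ← curlOfJacobian_sub]
  congr 1
  ext i j
  simp [hx j]

theorem divergence_sub_ae_eq (hΩ : IsOpen Ω) {A A' : E d → E d} (h : MemH1 Ω A)
    (h' : MemH1 Ω A') :
    divergence Ω (fun x => A x - A' x) =ᵐ[volume.restrict Ω]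
      fun x => divergence Ω A x - divergence Ω A' x := by
  filter_upwards [eventually_all.2 fun j => weakPartial_sub_ae_eq hΩ h h' j] with x hx
  simp [divergence, ← Finset.sum_sub_distrib, hx]

theorem MemH1.integrableOn_green {A : E d → E d} (h : MemH1 Ω A) {φ : E d → ℝ}
    (hφ : ContDiff ℝ (⊤ : ℕ∞) φ) (hφc : HasCompactSupport φ) :
    IntegrableOn (fun x => (∑ i : Fin d, A x i * fderiv ℝ φ x (basisVec i))
      + divergence Ω A x * φ x) Ω := by
  refine Integrable.add (integrable_finsetSum _ fun i _ => ?_) ?_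
  · have := integrableOn_smul_of_hasCompactSupport (continuous_fderiv_apply hφ (basisVec i))
      (hφc.fderiv_apply' (basisVec i)) (integrableOn_of_memLp_two (h.1.eval_piLp i))
    exact this.congr (.of_forall fun x => mul_comm _ _)
  · have := integrableOn_smul_of_hasCompactSupport hφ.continuous hφc
      (integrableOn_of_memLp_two h.memLp_divergence)
    exact this.congr (.of_forall fun x => mul_comm _ _)

theorem MemH1n.sub (hΩ : IsOpen Ω) {A A' : E d → E d} (h : MemH1n Ω A) (h' : MemH1n Ω A') :
    MemH1n Ω (fun x => A x - A' x) := by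
  refine ⟨h.1.sub h'.1, fun φ hφ hφc => ?_⟩
  rw [← sub_self (0 : ℝ)]
  nth_rewrite 1 [← h.2 φ hφ hφc]
  rw [← h'.2 φ hφ hφc, ← integral_sub (h.1.integrableOn_green hφ hφc)
    (h'.1.integrableOn_green hφ hφc)]
  refine integral_congr_ae ?_
  filter_upwards [divergence_sub_ae_eq hΩ h.1 h'.1] with x hx
  simp only [hx, PiLp.sub_apply, sub_mul, Finset.sum_sub_distrib]
  ring

theorem MemMagH1.sub {A : E d → E d} {ψ ψ' : E d → ℂ} (hA : MemH1 Ω A) (h : MemMagH1 Ω A ψ)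
    (h' : MemMagH1 Ω A ψ') : MemMagH1 Ω A (fun x => ψ x - ψ' x) := by
  refine ⟨h.1.sub h'.1, h.2.1.sub h'.2.1, ?_⟩
  refine MemLp.of_le (h.2.2.norm.add h'.2.2.norm)
    ((h.1.sub h'.1).1.norm.aestronglyMeasurable.smul hA.1.aestronglyMeasurable)
    (.of_forall fun x => ?_)
  simp only [norm_smul, norm_norm, Pi.add_apply]
  rw [Real.norm_of_nonneg (by positivity), ← add_mul]
  exact mul_le_mul_of_nonneg_right (norm_sub_le _ _) (norm_nonneg _)

theorem MemMagH1.const_mul (hΩ : IsOpen Ω) {A : E d → E d} {ψ : E d → ℂ} (h : MemMagH1 Ω A ψ)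
    (c : ℂ) : MemMagH1 Ω A (fun x => c * ψ x) := by
  refine ⟨h.1.const_mul hΩ c, h.2.1.const_mul c, ?_⟩
  simp only [norm_mul, mul_smul]
  exact h.2.2.const_smul ‖c‖

/-- Supplies the finite-energy conditions for the initial datum, which is only assumed to be in H¹
and bounded by one. -/
theorem memMagH1_of_bounded {A : E d → E d} (hA : MemH1 Ω A) {ψ : E d → ℂ} (hψ : MemH1 Ω ψ)
    {C : ℝ} (hC : ∀ᵐ x ∂(volume.restrict Ω), ‖ψ x‖ ≤ C) : MemMagH1 Ω A ψ := by
  refine ⟨hψ, MemLp.of_bound hψ.1.aestronglyMeasurable C hC, ?_⟩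
  refine MemLp.of_le_mul (c := C) hA.1
    (hψ.1.norm.aestronglyMeasurable.smul hA.1.aestronglyMeasurable) ?_
  filter_upwards [hC] with x hx
  rw [norm_smul, norm_norm]
  gcongr

theorem covGrad_sub_ae_eq (hΩ : IsOpen Ω) {A : E d → E d} {ψ ψ' : E d → ℂ} (h : MemH1 Ω ψ)
    (h' : MemH1 Ω ψ') (κ : ℝ) (j : Fin d) :
    covGrad Ω κ A (fun x => ψ x - ψ' x) j =ᵐ[volume.restrict Ω]
      fun x => covGrad Ω κ A ψ j x - covGrad Ω κ A ψ' j x := by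
  filter_upwards [weakPartial_sub_ae_eq hΩ h h' j] with x hx
  simp only [covGrad, hx]
  ring

end VectorFields

/-! ### Maximum principle for the order parameter. -/

section MaximumPrinciple

/-- The map `z ↦ h(|z|²) z` with a smooth cut-off `h` that vanishes exactly on `(-∞, 1]`. -/
def radialCutoff (z : ℂ) : ℂ := ((Real.smoothTransition (‖z‖ ^ 2 - 1) : ℝ) : ℂ) * z

theorem contDiff_radialCutoff : ContDiff ℝ 1 radialCutoff :=
  (Complex.ofRealCLM.contDiff.comp
    (Real.smoothTransition.contDiff.comp ((contDiff_norm_sq ℝ).sub contDiff_const))).mul contDiff_id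

theorem fderiv_radialCutoff (z w : ℂ) :
    fderiv ℝ radialCutoff z w = ((Real.smoothTransition (‖z‖ ^ 2 - 1) : ℝ) : ℂ) * w
      + ((deriv Real.smoothTransition (‖z‖ ^ 2 - 1) * (2 * inner ℝ z w) : ℝ) : ℂ) * z := by
  have h1 : HasFDerivAt (fun z : ℂ => ‖z‖ ^ 2 - 1) (2 • innerSL ℝ z) z :=
    (hasStrictFDerivAt_norm_sq z).hasFDerivAt.sub_const 1
  have h2 : HasDerivAt Real.smoothTransition (deriv Real.smoothTransition (‖z‖ ^ 2 - 1))
      (‖z‖ ^ 2 - 1) :=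
    ((Real.smoothTransition.contDiff (n := 1)).differentiable one_ne_zero _).hasDerivAt
  have h3 := (h2.comp_hasFDerivAt z h1)
  have h4 : HasFDerivAt radialCutoff _ z :=
    (Complex.ofRealCLM.hasFDerivAt.comp z h3).mul (hasFDerivAt_id z)
  rw [h4.fderiv]
  simp [Complex.ofRealCLM]
  ring

/-- Outside the ball of radius 2 the map is the identity; on the ball compactness applies. -/
theorem exists_norm_fderiv_radialCutoff_le : ∃ C, ∀ z, ‖fderiv ℝ radialCutoff z‖ ≤ C := by
  obtain ⟨B, hB⟩ := (isCompact_closedBall (0 : ℂ) 2).exists_bound_of_continuousOn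
    (contDiff_radialCutoff.continuous_fderiv one_ne_zero).continuousOn
  refine ⟨max B 1, fun z => ?_⟩
  by_cases hz : z ∈ Metric.closedBall (0 : ℂ) 2
  · exact (hB z hz).trans (le_max_left _ _)
  · have hz' : 2 < ‖z‖ := by simpa using hz
    have : radialCutoff =ᶠ[𝓝 z] id := by
      filter_upwards [continuous_norm.continuousAt.eventually (lt_mem_nhds hz')] with y hy
      rw [radialCutoff, Real.smoothTransition.one_of_one_le (by nlinarith)]
      simp
    rw [this.fderiv_eq, fderiv_id]
    exact ContinuousLinearMap.norm_id_le.trans (le_max_right _ _)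

theorem norm_radialCutoff_le (z : ℂ) : ‖radialCutoff z‖ ≤ ‖z‖ := by
  rw [radialCutoff, norm_mul, Complex.norm_real,
    Real.norm_of_nonneg (Real.smoothTransition.nonneg _)]
  exact mul_le_of_le_one_left (norm_nonneg _) (Real.smoothTransition.le_one _)

/-- The product equals `h |(i/κ)p + az|² + 2k κ⁻² ⟨z, p⟩²`: the cross term of `az` with the
derivative of the cut-off is purely imaginary. Here `h` and `k` stand for the cut-off and its
derivative. -/
theorem re_covGrad_mul_star_nonneg (κ a h k : ℝ) (hh : 0 ≤ h) (hk : 0 ≤ k) (z p : ℂ) :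
    0 ≤ ((Complex.I / (κ : ℂ) * p + (a : ℂ) * z) * star (Complex.I / (κ : ℂ) *
      ((h : ℂ) * p + ((k * (2 * inner ℝ z p) : ℝ) : ℂ) * z) + (a : ℂ) * ((h : ℂ) * z))).re := by
  have hI : Complex.I / (κ : ℂ) = Complex.I * ((κ⁻¹ : ℝ) : ℂ) := by
    rw [div_eq_mul_inv, Complex.ofReal_inv]
  rw [hI]
  generalize κ⁻¹ = t
  have : ((Complex.I * (t : ℂ) * p + (a : ℂ) * z) * star (Complex.I * (t : ℂ) *
      ((h : ℂ) * p + ((k * (2 * inner ℝ z p) : ℝ) : ℂ) * z) + (a : ℂ) * ((h : ℂ) * z))).re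
      = h * ((a * z.re - t * p.im) ^ 2 + (a * z.im + t * p.re) ^ 2)
        + 2 * k * t ^ 2 * (z.re * p.re + z.im * p.im) ^ 2 := by
    simp [Complex.inner]
    ring
  rw [this]
  positivity

/-- The expression is `h ((c + |p|²)|z|² - (c + 1)⟨z, p⟩)`. For `|z| > 1` the bracket is positive
because `(c + |p|²) - (c + 1)|p| = (1 - |p|)(c - |p|) ≥ 0`. With `c = η / τ`, this is where `τ ≤ η`
is needed. -/
theorem re_reaction_mul_star_nonneg {c h : ℝ} (hc : 1 ≤ c) (hh : 0 ≤ h) {z p : ℂ} (hp : ‖p‖ ≤ 1)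
    (hz : h ≠ 0 → 1 < ‖z‖) :
    0 ≤ ((c : ℂ) * (z - p) * star ((h : ℂ) * z)
        + (((‖p‖ ^ 2 : ℝ) : ℂ) * z - p) * star ((h : ℂ) * z)).re ∧
      (((c : ℂ) * (z - p) * star ((h : ℂ) * z)
        + (((‖p‖ ^ 2 : ℝ) : ℂ) * z - p) * star ((h : ℂ) * z)).re = 0 → h = 0) := by
  have e : ((c : ℂ) * (z - p) * star ((h : ℂ) * z)
        + (((‖p‖ ^ 2 : ℝ) : ℂ) * z - p) * star ((h : ℂ) * z)).re
      = h * ((c + ‖p‖ ^ 2) * ‖z‖ ^ 2 - (c + 1) * inner ℝ z p) := by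
    rw [← Complex.normSq_eq_norm_sq z, Complex.normSq_apply]
    generalize ‖p‖ ^ 2 = b
    simp [Complex.inner]
    ring
  rw [e]
  rcases eq_or_ne h 0 with h0 | h0
  · simp [h0]
  have hz1 := hz h0
  have hpos : 0 < (c + ‖p‖ ^ 2) * ‖z‖ ^ 2 - (c + 1) * inner ℝ z p := by
    have h1 := real_inner_le_norm z p
    have h2 := norm_nonneg p
    have h3 : 0 ≤ (1 - ‖p‖) * (c - ‖p‖) := mul_nonneg (by linarith) (by linarith)
    have h4 : 0 < (c + ‖p‖ ^ 2) * ‖z‖ - (c + 1) * ‖p‖ := by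
      nlinarith [mul_pos (show 0 < c + ‖p‖ ^ 2 by positivity) (sub_pos.2 hz1)]
    nlinarith [mul_pos (zero_lt_one.trans hz1) h4]
  have hh' : 0 < h := lt_of_le_of_ne hh h0.symm
  exact ⟨by positivity, fun h' => absurd h' (by positivity)⟩

variable {d : ℕ} {Ω : Set (E d)}

theorem integrable_orderParameterEq {κ η τ : ℝ} {ψ ψb φ : E d → ℂ} {A : E d → E d}
    (hA : MemH1 Ω A) (hψ2 : MemLp ψ 2 (volume.restrict Ω))
    (hψ : ∀ᵐ x ∂(volume.restrict Ω), ‖ψ x‖ ≤ 1) (hψb : MemMagH1 Ω A ψb) (hφ : MemMagH1 Ω A φ) :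
    IntegrableOn (fun x => (η : ℂ) * ((ψb x - ψ x) / (τ : ℂ)) * star (φ x)
        + (∑ j : Fin d, covGrad Ω κ A ψb j x * star (covGrad Ω κ A φ j x))
        + (((‖ψ x‖ ^ 2 : ℝ) : ℂ) * ψb x - ψ x) * star (φ x)) Ω := by
  have hstar {f g : E d → ℂ} (hf : MemLp f 2 (volume.restrict Ω))
      (hg : MemLp g 2 (volume.restrict Ω)) :
      Integrable (fun x => f x * star (g x)) (volume.restrict Ω) :=
    hf.integrable_mul hg.star
  refine ((hstar ?_ hφ.1.1).add (integrable_finsetSum _ fun j _ =>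
    hstar (hψb.memLp_covGrad hA κ j) (hφ.memLp_covGrad hA κ j))).add (hstar ?_ hφ.1.1)
  · simp only [div_eq_mul_inv]
    exact ((hψb.1.1.sub hψ2).mul_const _).const_mul _
  · refine MemLp.sub (MemLp.of_le hψb.1.1 ?_ ?_) hψ2
    · exact (Complex.continuous_ofReal.comp_aestronglyMeasurable
        (hψ2.aestronglyMeasurable.norm.pow 2)).mul hψb.1.1.aestronglyMeasurable
    · filter_upwards [hψ] with x hx
      rw [norm_mul, Complex.norm_real, Real.norm_of_nonneg (by positivity)]
      exact mul_le_of_le_one_left (norm_nonneg _) (pow_le_one₀ (norm_nonneg _) hx)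

theorem SolvesOrderParameterEq.integral_re_eq_zero {κ η τ : ℝ} {ψ ψb φ : E d → ℂ} {A : E d → E d}
    (h : SolvesOrderParameterEq Ω κ η τ ψ A ψb)
    (hA : MemH1 Ω A) (hψ2 : MemLp ψ 2 (volume.restrict Ω))
    (hψ : ∀ᵐ x ∂(volume.restrict Ω), ‖ψ x‖ ≤ 1) (hφ : MemMagH1 Ω A φ) :
    ∫ x in Ω, ((η : ℂ) * ((ψb x - ψ x) / (τ : ℂ)) * star (φ x)
        + (∑ j : Fin d, covGrad Ω κ A ψb j x * star (covGrad Ω κ A φ j x))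
        + (((‖ψ x‖ ^ 2 : ℝ) : ℂ) * ψb x - ψ x) * star (φ x)).re = 0 := by
  have := integral_re (𝕜 := ℂ)
    (integrable_orderParameterEq (κ := κ) (η := η) (τ := τ) hA hψ2 hψ h.1 hφ)
  simp only [RCLike.re_to_complex] at this
  rw [this, h.2 φ hφ, Complex.zero_re]

variable [IsFiniteMeasure ((volume : Measure (E d)).restrict Ω)]

/-- The maximum principle for the discrete order parameter equation. -/
theorem SolvesOrderParameterEq.norm_le_one {κ η τ : ℝ} {ψ ψb : E d → ℂ} {A : E d → E d}
    (h : SolvesOrderParameterEq Ω κ η τ ψ A ψb) (hΩ : IsOpen Ω) (hτ : 0 < τ) (hτη : τ ≤ η)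
    (hA : MemH1 Ω A) (hψ2 : MemLp ψ 2 (volume.restrict Ω))
    (hψ : ∀ᵐ x ∂(volume.restrict Ω), ‖ψ x‖ ≤ 1) :
    ∀ᵐ x ∂(volume.restrict Ω), ‖ψb x‖ ≤ 1 := by
  obtain ⟨C, hC⟩ := exists_norm_fderiv_radialCutoff_le
  have hψb := h.1
  have hφ1 : MemH1 Ω (fun x => radialCutoff (ψb x)) :=
    hψb.1.comp_contDiff hΩ contDiff_radialCutoff (by simp [radialCutoff]) hC
  have hφ : MemMagH1 Ω A (fun x => radialCutoff (ψb x)) := by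
    refine ⟨hφ1, hψb.2.1.of_le hφ1.1.aestronglyMeasurable
      (.of_forall fun x => norm_radialCutoff_le _), hψb.2.2.of_le
      (hφ1.1.norm.aestronglyMeasurable.smul hA.1.aestronglyMeasurable) (.of_forall fun x => ?_)⟩
    simp only [norm_smul, norm_norm]
    exact mul_le_mul_of_nonneg_right (norm_radialCutoff_le _) (norm_nonneg _)
  have hint := (integrable_orderParameterEq (κ := κ) (η := η) (τ := τ) hA hψ2 hψ hψb hφ).re
  have hzero := h.integral_re_eq_zero hA hψ2 hψ hφ
  have hc : 1 ≤ η / τ := (one_le_div hτ).2 hτη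
  have hre : ∀ᵐ x ∂(volume.restrict Ω), 0 ≤ ((η : ℂ) * ((ψb x - ψ x) / (τ : ℂ))
        * star (radialCutoff (ψb x))
        + (∑ j : Fin d, covGrad Ω κ A ψb j x
          * star (covGrad Ω κ A (fun x => radialCutoff (ψb x)) j x))
        + (((‖ψ x‖ ^ 2 : ℝ) : ℂ) * ψb x - ψ x) * star (radialCutoff (ψb x))).re ∧
      (((η : ℂ) * ((ψb x - ψ x) / (τ : ℂ)) * star (radialCutoff (ψb x))
        + (∑ j : Fin d, covGrad Ω κ A ψb j x
          * star (covGrad Ω κ A (fun x => radialCutoff (ψb x)) j x))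
        + (((‖ψ x‖ ^ 2 : ℝ) : ℂ) * ψb x - ψ x) * star (radialCutoff (ψb x))).re = 0 →
        ‖ψb x‖ ≤ 1) := by
    filter_upwards [hψ, eventually_all.2 fun j =>
      weakPartial_comp_ae_eq hΩ hψb.1 contDiff_radialCutoff hC j] with x hx hgrad
    have hsum : 0 ≤ (∑ j : Fin d, covGrad Ω κ A ψb j x
          * star (covGrad Ω κ A (fun x => radialCutoff (ψb x)) j x)).re := by
      rw [Complex.re_sum]
      refine Finset.sum_nonneg fun j _ => ?_
      simp only [covGrad, hgrad j, fderiv_radialCutoff]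
      exact re_covGrad_mul_star_nonneg κ _ _ _ (Real.smoothTransition.nonneg _)
        (Real.smoothTransition.monotone.deriv_nonneg) _ _
    have hreac := re_reaction_mul_star_nonneg (c := η / τ)
      (h := Real.smoothTransition (‖ψb x‖ ^ 2 - 1)) (z := ψb x) hc
      (Real.smoothTransition.nonneg _) hx (fun h' => by
        by_contra! hle
        exact h' (Real.smoothTransition.zero_of_nonpos (by nlinarith [norm_nonneg (ψb x)])))
    have e : (η : ℂ) * ((ψb x - ψ x) / (τ : ℂ)) = ((η / τ : ℝ) : ℂ) * (ψb x - ψ x) := by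
      push_cast; ring
    rw [e, add_right_comm, Complex.add_re]
    refine ⟨add_nonneg hreac.1 hsum, fun h0 => ?_⟩
    -- If the sum of the two nonnegative parts vanishes, so does the reaction part; then the cut-off
    -- is zero, which happens only for `‖ψb x‖ ≤ 1`.
    have := hreac.2 (le_antisymm (by
      simp only [radialCutoff] at h0 hsum ⊢; linarith) hreac.1)
    rw [Real.smoothTransition.zero_iff_nonpos] at this
    nlinarith [norm_nonneg (ψb x)]
  have := (integral_eq_zero_iff_of_nonneg_ae (hre.mono fun x hx => hx.1) hint).1 hzero
  filter_upwards [hre, this] with x hx h0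
  exact hx.2 h0

end MaximumPrinciple

/-! ### Pointwise inequalities behind the energy estimate. -/

section Pointwise

theorem half_sq_sub_sq_le_inner {V : Type*} [NormedAddCommGroup V] [InnerProductSpace ℝ V]
    (x y : V) : (‖x‖ ^ 2 - ‖y‖ ^ 2) / 2 ≤ inner ℝ x (x - y) := by
  rw [inner_sub_right, real_inner_self_eq_norm_sq]
  nlinarith [norm_sub_sq_real x y, sq_nonneg ‖x - y‖]

theorem re_mul_star_eq_inner (z w : ℂ) : (z * star w).re = inner ℝ z w := by
  simp [Complex.inner]
  ring

/-- Two convexity inequalities for the staggered scheme: from `y` to `x` only the order parameter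
changes, from `x` to `x + z` only the potential, with `z = (A' - A) ψbar`. -/
theorem half_sq_sub_sq_le_re (x y z : ℂ) :
    (‖x + z‖ ^ 2 - ‖y‖ ^ 2) / 2 ≤ (x * star (x - y)).re + ((x + z) * star z).re := by
  have h1 := half_sq_sub_sq_le_inner x y
  have h2 := half_sq_sub_sq_le_inner (x + z) x
  rw [add_sub_cancel_left] at h2
  rw [re_mul_star_eq_inner, re_mul_star_eq_inner]
  linarith

/-- Identifies supercurrent plus `|ψbar|² A` as the derivative of half the squared covariant
gradient in the potential, the form needed to pair with `half_sq_sub_sq_le_re`. -/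
theorem supercurrent_mul_add (κ a v : ℝ) (z p : ℂ) :
    ((Complex.I / (2 * (κ : ℂ))) * (star z * p - z * star p)).re * v + ‖z‖ ^ 2 * (a * v)
      = ((Complex.I / (κ : ℂ) * p + (a : ℂ) * z) * star ((v : ℂ) * z)).re := by
  have hI : Complex.I / (κ : ℂ) = Complex.I * ((κ⁻¹ : ℝ) : ℂ) := by
    rw [div_eq_mul_inv, Complex.ofReal_inv]
  have hI2 : Complex.I / (2 * (κ : ℂ)) = Complex.I * ((κ⁻¹ / 2 : ℝ) : ℂ) := by
    push_cast
    rw [div_eq_mul_inv, mul_inv]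
    ring
  rw [hI, hI2]
  generalize κ⁻¹ = t
  rw [← Complex.normSq_eq_norm_sq z, Complex.normSq_apply, Complex.ofReal_div]
  simp
  ring

theorem re_reaction_eq (c : ℝ) (z w : ℂ) :
    ((c : ℂ) * (z - w) * star (z - w) + (((‖w‖ ^ 2 : ℝ) : ℂ) * z - w) * star (z - w)).re
      = c * ‖z - w‖ ^ 2
        + ((‖z‖ ^ 2 - ‖w‖ ^ 2) * (‖w‖ ^ 2 - 1) + (‖w‖ ^ 2 + 1) * ‖z - w‖ ^ 2) / 2 := by
  have e : ((c : ℂ) * (z - w) * star (z - w)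
      + (((‖w‖ ^ 2 : ℝ) : ℂ) * z - w) * star (z - w)).re
      = c * Complex.normSq (z - w)
        + ((‖w‖ ^ 2 * z.re - w.re) * (z.re - w.re) + (‖w‖ ^ 2 * z.im - w.im) * (z.im - w.im)) := by
    rw [Complex.normSq_apply]
    generalize ‖w‖ ^ 2 = b
    simp
    ring
  rw [e]
  simp only [← Complex.normSq_eq_norm_sq]
  simp only [Complex.normSq_apply, Complex.sub_re, Complex.sub_im]
  ring

theorem sq_norm_sq_sub_le (z w : ℂ) :
    (‖z‖ ^ 2 - ‖w‖ ^ 2) ^ 2 ≤ (‖z‖ + ‖w‖) ^ 2 * ‖z - w‖ ^ 2 := by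
  have h := abs_norm_sub_norm_le z w
  have h2 : (‖z‖ - ‖w‖) ^ 2 ≤ ‖z - w‖ ^ 2 := by
    rw [← sq_abs (‖z‖ - ‖w‖)]
    gcongr
  calc (‖z‖ ^ 2 - ‖w‖ ^ 2) ^ 2 = (‖z‖ + ‖w‖) ^ 2 * (‖z‖ - ‖w‖) ^ 2 := by ring
    _ ≤ _ := by gcongr

/-- By `re_reaction_eq`, right minus left is `(c + (|w|² + 1)/2)|z - w|² - (|z|² - |w|²)²/4`. As
`|z| + |w| ≤ 2`, the subtracted term is at most `|z - w|² ≤ c|z - w|²`. -/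
theorem potential_sub_le_re_reaction {c : ℝ} (hc : 1 ≤ c) {z w : ℂ} (hz : ‖z‖ ≤ 1) (hw : ‖w‖ ≤ 1) :
    ((1 / 2) * (‖z‖ ^ 2 - 1) ^ 2 - (1 / 2) * (‖w‖ ^ 2 - 1) ^ 2) / 2 ≤
      ((c : ℂ) * (z - w) * star (z - w)
        + (((‖w‖ ^ 2 : ℝ) : ℂ) * z - w) * star (z - w)).re := by
  rw [re_reaction_eq]
  have h1 := sq_norm_sq_sub_le z w
  have h2 : (‖z‖ + ‖w‖) ^ 2 ≤ 4 := by nlinarith [norm_nonneg z, norm_nonneg w]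
  have h3 : (‖z‖ ^ 2 - ‖w‖ ^ 2) ^ 2 ≤ 4 * ‖z - w‖ ^ 2 := h1.trans (by gcongr)
  have h4 : ‖z - w‖ ^ 2 ≤ c * ‖z - w‖ ^ 2 := le_mul_of_one_le_left (by positivity) hc
  nlinarith [mul_nonneg (sq_nonneg ‖w‖) (sq_nonneg ‖z - w‖), sq_nonneg ‖z - w‖]

/-- For `|z| = 1` the expression is at least `(1 - |w|)|z - w|²`, which settles equality if `|w| <
1`; if `|w| = 1` it equals `(c + 1)|z - w|²`. -/
theorem re_reaction_nonneg_of_norm_eq_one {c : ℝ} (hc : 1 ≤ c) {z w : ℂ} (hz : ‖z‖ = 1)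
    (hw : ‖w‖ ≤ 1) :
    0 ≤ ((c : ℂ) * (z - w) * star (z - w)
        + (((‖w‖ ^ 2 : ℝ) : ℂ) * z - w) * star (z - w)).re ∧
      (((c : ℂ) * (z - w) * star (z - w)
        + (((‖w‖ ^ 2 : ℝ) : ℂ) * z - w) * star (z - w)).re = 0 → z = w) := by
  rw [re_reaction_eq, hz]
  have h1 := sq_norm_sq_sub_le z w
  rw [hz] at h1
  have h4 : ‖z - w‖ ^ 2 ≤ c * ‖z - w‖ ^ 2 := le_mul_of_one_le_left (by positivity) hc
  have h5 := sq_nonneg ‖z - w‖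
  have h0 := norm_nonneg w
  have key : (1 - ‖w‖) * ‖z - w‖ ^ 2 ≤ c * ‖z - w‖ ^ 2
      + ((1 ^ 2 - ‖w‖ ^ 2) * (‖w‖ ^ 2 - 1) + (‖w‖ ^ 2 + 1) * ‖z - w‖ ^ 2) / 2 := by
    nlinarith
  refine ⟨(mul_nonneg (by linarith) h5).trans key, fun h => ?_⟩
  rw [h] at key
  have hd : ‖z - w‖ ^ 2 = 0 := by
    rcases hw.eq_or_lt with hw1 | hw1
    · rw [hw1] at h
      nlinarith
    · nlinarith [mul_nonneg (sub_pos.2 hw1).le h5, mul_pos_iff_of_pos_left (sub_pos.2 hw1) (b := ‖z - w‖ ^ 2)]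
  exact sub_eq_zero.1 (norm_eq_zero.1 (pow_eq_zero_iff two_ne_zero |>.1 hd))

end Pointwise

/-! ### Energy decay and rigidity of zero energy in Step 1. -/

section Energy

variable {d : ℕ} {Ω : Set (E d)}

/-- The integrand of the Ginzburg-Landau energy. -/
def energyDensity (Ω : Set (E d)) (κ : ℝ) (H : E d → E (d.choose 2)) (ψ : E d → ℂ)
    (A : E d → E d) (x : E d) : ℝ :=
  (∑ j : Fin d, ‖covGrad Ω κ A ψ j x‖ ^ 2) + (1 / 2) * (‖ψ x‖ ^ 2 - 1) ^ 2
    + ‖curl Ω A x - H x‖ ^ 2 + divergence Ω A x ^ 2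

theorem energy_eq_integral (κ : ℝ) (H : E d → E (d.choose 2)) (ψ : E d → ℂ) (A : E d → E d) :
    energy Ω κ H ψ A = ∫ x in Ω, energyDensity Ω κ H ψ A x :=
  rfl

theorem energyDensity_nonneg (κ : ℝ) (H : E d → E (d.choose 2)) (ψ : E d → ℂ) (A : E d → E d)
    (x : E d) : 0 ≤ energyDensity Ω κ H ψ A x := by
  unfold energyDensity
  positivity

theorem energy_nonneg (κ : ℝ) (H : E d → E (d.choose 2)) (ψ : E d → ℂ) (A : E d → E d) :
    0 ≤ energy Ω κ H ψ A :=
  integral_nonneg fun x => energyDensity_nonneg κ H ψ A x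

theorem dissipation_nonneg (τ : ℝ) (ψ ψ' : E d → ℂ) (A A' : E d → E d) :
    0 ≤ dissipation Ω τ ψ ψ' A A' :=
  integral_nonneg fun x => by positivity

theorem energy_congr (κ : ℝ) (H : E d → E (d.choose 2)) {ψ ψ' : E d → ℂ} {A A' : E d → E d}
    (hψ : ψ =ᵐ[volume.restrict Ω] ψ') (hA : A =ᵐ[volume.restrict Ω] A') :
    energy Ω κ H ψ A = energy Ω κ H ψ' A' := by
  refine integral_congr_ae ?_
  filter_upwards [hψ, hA] with x hx hx'
  simp only [covGrad, curl, divergence, weakPartial_congr hψ, weakPartial_congr hA, hx, hx']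

theorem integrable_inner_of_memLp_two {V : Type*} [NormedAddCommGroup V] [InnerProductSpace ℝ V]
    {X : Type*} [MeasurableSpace X] {μ : Measure X} {f g : X → V} (hf : MemLp f 2 μ)
    (hg : MemLp g 2 μ) : Integrable (fun x => inner ℝ (f x) (g x)) μ := by
  rw [← memLp_one_iff_integrable]
  exact (innerSL ℝ).memLp_of_bilin 1 hf hg

/-- The tested equation for the potential in terms of the covariant gradient. -/
theorem SolvesPotentialEq.integral_eq_zero {κ τ : ℝ} {H : E d → E (d.choose 2)} {A A' : E d → E d}
    {ψb : E d → ℂ} (h : SolvesPotentialEq Ω κ τ H A ψb A') {v : E d → E d} (hv : MemH1n Ω v)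
    (hv' : MemLp (fun x => ‖ψb x‖ • v x) 2 (volume.restrict Ω)) :
    ∫ x in Ω, (inner ℝ (τ⁻¹ • (A' x - A x)) (v x)
        + inner ℝ (curl Ω A' x - H x) (curl Ω v x)
        + divergence Ω A' x * divergence Ω v x
        + ∑ j : Fin d, (covGrad Ω κ A' ψb j x * star ((v x j : ℂ) * ψb x)).re) = 0 := by
  rw [← h.2.2 v hv hv']
  refine integral_congr_ae (.of_forall fun x => ?_)
  simp only
  rw [add_assoc _ (∑ j : Fin d, _) (‖ψb x‖ ^ 2 * _)]
  congr 1
  rw [PiLp.inner_apply, Finset.mul_sum, ← Finset.sum_add_distrib]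
  refine Finset.sum_congr rfl fun j _ => ?_
  rw [covGrad, ← supercurrent_mul_add]
  simp [mul_comm]

theorem integrable_potentialEq {κ τ : ℝ} {H : E d → E (d.choose 2)}
    (hH : MemLp H 2 (volume.restrict Ω)) {A A' : E d → E d} {ψb : E d → ℂ} (hA : MemH1 Ω A)
    (hA' : MemH1 Ω A') (hψb : MemMagH1 Ω A' ψb) {v : E d → E d} (hv : MemH1 Ω v)
    (hv' : MemLp (fun x => ‖ψb x‖ • v x) 2 (volume.restrict Ω)) :
    IntegrableOn (fun x => inner ℝ (τ⁻¹ • (A' x - A x)) (v x)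
        + inner ℝ (curl Ω A' x - H x) (curl Ω v x)
        + divergence Ω A' x * divergence Ω v x
        + ∑ j : Fin d, (covGrad Ω κ A' ψb j x * star ((v x j : ℂ) * ψb x)).re) Ω := by
  refine (((integrable_inner_of_memLp_two ((hA'.1.sub hA.1).const_smul τ⁻¹) hv.1).add
    (integrable_inner_of_memLp_two (hA'.memLp_curl.sub hH) hv.memLp_curl)).add
    (hA'.memLp_divergence.integrable_mul hv.memLp_divergence)).add
    (integrable_finsetSum _ fun j _ => ?_)
  simp only [re_mul_star_eq_inner]
  refine integrable_inner_of_memLp_two (hψb.memLp_covGrad hA' κ j) (hv'.of_le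
    ((Complex.continuous_ofReal.comp_aestronglyMeasurable
      (hv.1.eval_piLp j).aestronglyMeasurable).mul hψb.1.1.aestronglyMeasurable)
    (.of_forall fun x => ?_))
  simp only [norm_mul, norm_smul, norm_norm, Complex.norm_real]
  rw [mul_comm]
  gcongr
  exact PiLp.norm_apply_le (v x) j

theorem memLp_norm_smul_of_bounded {v : E d → E d} (hv : MemLp v 2 (volume.restrict Ω))
    {ψ : E d → ℂ} (hψ : AEStronglyMeasurable ψ (volume.restrict Ω)) {C : ℝ}
    (hC : ∀ᵐ x ∂(volume.restrict Ω), ‖ψ x‖ ≤ C) :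
    MemLp (fun x => ‖ψ x‖ • v x) 2 (volume.restrict Ω) := by
  refine MemLp.of_le_mul (c := C) hv (hψ.norm.smul hv.aestronglyMeasurable) ?_
  filter_upwards [hC] with x hx
  rw [norm_smul, norm_norm]
  gcongr

variable [IsFiniteMeasure ((volume : Measure (E d)).restrict Ω)]

theorem integrable_energyDensity {κ : ℝ} {H : E d → E (d.choose 2)}
    (hH : MemLp H 2 (volume.restrict Ω)) {ψ : E d → ℂ} {A : E d → E d} (hA : MemH1 Ω A)
    (h : MemMagH1 Ω A ψ) : IntegrableOn (energyDensity Ω κ H ψ A) Ω := by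
  refine (((integrable_finsetSum _ fun j _ =>
    (h.memLp_covGrad hA κ j).integrable_norm_pow two_ne_zero).add ?_).add
      ((hA.memLp_curl.sub hH).integrable_norm_pow two_ne_zero)).add hA.memLp_divergence.integrable_sq
  have h4 : Integrable (fun x => ‖ψ x‖ ^ 4) (volume.restrict Ω) :=
    MemLp.integrable_norm_pow (p := 4) (by exact_mod_cast h.2.1) (by norm_num)
  have h2 := h.1.1.integrable_norm_pow two_ne_zero
  refine (((h4.sub (h2.const_mul 2)).add (integrable_const 1)).const_mul (1 / 2)).congr
    (.of_forall fun x => ?_)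
  simp only [Pi.add_apply, Pi.sub_apply]
  ring

/-- One step of the scheme does not increase the energy before the order parameter is rescaled. -/
theorem energy_le_of_solves {κ η τ : ℝ} {H : E d → E (d.choose 2)} {ψ ψb : E d → ℂ}
    {A A' : E d → E d} (hΩ : IsOpen Ω) (hτ : 0 < τ) (hτη : τ ≤ η)
    (hH : MemLp H 2 (volume.restrict Ω)) (hA : MemH1n Ω A) (hψA : MemMagH1 Ω A ψ)
    (hψ : ∀ᵐ x ∂(volume.restrict Ω), ‖ψ x‖ ≤ 1)
    (h1 : SolvesOrderParameterEq Ω κ η τ ψ A ψb) (h2 : SolvesPotentialEq Ω κ τ H A ψb A') :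
    energy Ω κ H ψb A' ≤ energy Ω κ H ψ A := by
  have hψb := h1.norm_le_one hΩ hτ hτη hA.1 hψA.1.1 hψ
  have hA' := h2.1
  have hφ := h1.1.sub hA.1 hψA
  have hv := hA'.sub hΩ hA
  have hv' := memLp_norm_smul_of_bounded hv.1.1 h1.1.1.1.aestronglyMeasurable hψb
  have i1 := (integrable_orderParameterEq (κ := κ) (η := η) (τ := τ) hA.1 hψA.1.1 hψ h1.1 hφ).re
  have i2 := integrable_potentialEq (κ := κ) (τ := τ) hH hA.1 hA'.1 h2.2.1 hv.1 hv'
  have e1 := h1.integral_re_eq_zero hA.1 hψA.1.1 hψ hφ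
  have e2 := h2.integral_eq_zero hv hv'
  have ib := integrable_energyDensity (κ := κ) hH hA'.1 h2.2.1
  have i0 := integrable_energyDensity (κ := κ) hH hA.1 hψA
  have hc : 1 ≤ η / τ := (one_le_div hτ).2 hτη
  -- Half the increment of the energy density is bounded pointwise by the sum of the two tested
  -- integrands, each of which integrates to zero.
  have hmain := integral_mono_ae ((ib.sub i0).div_const 2) (i1.add i2) (by
    filter_upwards [hψ, hψb, curl_sub_ae_eq hΩ hA'.1 hA.1, divergence_sub_ae_eq hΩ hA'.1 hA.1,
      eventually_all.2 fun j => covGrad_sub_ae_eq hΩ (A := A) h1.1.1 hψA.1 κ j]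
      with x hx hxb hcurl hdiv hcov
    simp only [Pi.add_apply, Pi.sub_apply, RCLike.re_to_complex, energyDensity, hcurl, hdiv, hcov]
    have e : (η : ℂ) * ((ψb x - ψ x) / (τ : ℂ)) = ((η / τ : ℝ) : ℂ) * (ψb x - ψ x) := by
      push_cast; ring
    simp only [e, Complex.add_re, Complex.re_sum]
    have t1 := potential_sub_le_re_reaction hc hxb hx
    rw [Complex.add_re] at t1
    have t2 : (0 : ℝ) ≤ inner ℝ (τ⁻¹ • (A' x - A x)) (A' x - A x) := by
      rw [real_inner_smul_left, real_inner_self_eq_norm_sq]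
      positivity
    have t3 := half_sq_sub_sq_le_inner (curl Ω A' x - H x) (curl Ω A x - H x)
    rw [sub_sub_sub_cancel_right] at t3
    have t4 : (divergence Ω A' x ^ 2 - divergence Ω A x ^ 2) / 2
        ≤ divergence Ω A' x * (divergence Ω A' x - divergence Ω A x) := by
      nlinarith [sq_nonneg (divergence Ω A' x - divergence Ω A x)]
    have t5 := Finset.sum_le_sum fun j (_ : j ∈ (Finset.univ : Finset (Fin d))) =>
      half_sq_sub_sq_le_re (covGrad Ω κ A ψb j x) (covGrad Ω κ A ψ j x)
        ((((A' x - A x) j : ℝ) : ℂ) * ψb x)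
    have hadd (j) : covGrad Ω κ A ψb j x + (((A' x - A x) j : ℝ) : ℂ) * ψb x
        = covGrad Ω κ A' ψb j x := by
      simp only [covGrad, PiLp.sub_apply, Complex.ofReal_sub]
      ring
    simp only [hadd] at t5
    rw [← Finset.sum_div, Finset.sum_sub_distrib, Finset.sum_add_distrib] at t5
    linarith)
  simp only [Pi.add_apply, Pi.sub_apply, RCLike.re_to_complex] at hmain
  rw [integral_div, integral_sub ib i0] at hmain
  rw [integral_add (by exact i1) i2] at hmain
  rw [energy_eq_integral, energy_eq_integral]
  linarith

/-- If the intermediate energy vanishes, so does the energy at the beginning of the step. -/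
theorem energy_eq_zero_of_solves {κ η τ : ℝ} {H : E d → E (d.choose 2)} {ψ ψb : E d → ℂ}
    {A A' : E d → E d} (hΩ : IsOpen Ω) (hτ : 0 < τ) (hτη : τ ≤ η)
    (hH : MemLp H 2 (volume.restrict Ω)) (hA : MemH1n Ω A) (hψA : MemMagH1 Ω A ψ)
    (hψ : ∀ᵐ x ∂(volume.restrict Ω), ‖ψ x‖ ≤ 1)
    (h1 : SolvesOrderParameterEq Ω κ η τ ψ A ψb) (h2 : SolvesPotentialEq Ω κ τ H A ψb A')
    (h0 : energy Ω κ H ψb A' = 0) : energy Ω κ H ψ A = 0 := by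
  have hψb := h1.norm_le_one hΩ hτ hτη hA.1 hψA.1.1 hψ
  have hA' := h2.1
  have hφ := h1.1.sub hA.1 hψA
  have hv := hA'.sub hΩ hA
  have hv' := memLp_norm_smul_of_bounded hv.1.1 h1.1.1.1.aestronglyMeasurable hψb
  have i1 := (integrable_orderParameterEq (κ := κ) (η := η) (τ := τ) hA.1 hψA.1.1 hψ h1.1 hφ).re
  have i2 := integrable_potentialEq (κ := κ) (τ := τ) hH hA.1 hA'.1 h2.2.1 hv.1 hv'
  have e1 := h1.integral_re_eq_zero hA.1 hψA.1.1 hψ hφ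
  have e2 := h2.integral_eq_zero hv hv'
  have ib := integrable_energyDensity (κ := κ) hH hA'.1 h2.2.1
  have hc : 1 ≤ η / τ := (one_le_div hτ).2 hτη
  have hdens := (integral_eq_zero_iff_of_nonneg (energyDensity_nonneg κ H ψb A') ib).1 h0
  have hzero : ∀ᵐ x ∂(volume.restrict Ω), (∀ j, covGrad Ω κ A' ψb j x = 0) ∧ ‖ψb x‖ = 1 ∧
      curl Ω A' x - H x = 0 ∧ divergence Ω A' x = 0 := by
    filter_upwards [hdens] with x hx
    simp only [energyDensity, Pi.zero_apply] at hx
    have a1 : 0 ≤ ∑ j : Fin d, ‖covGrad Ω κ A' ψb j x‖ ^ 2 := by positivity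
    have a2 := sq_nonneg (‖ψb x‖ ^ 2 - 1)
    have a3 := sq_nonneg ‖curl Ω A' x - H x‖
    have a4 := sq_nonneg (divergence Ω A' x)
    refine ⟨fun j => ?_, ?_, ?_, ?_⟩
    · have := (Finset.sum_eq_zero_iff_of_nonneg (fun j _ => by positivity)).1
        (show ∑ j : Fin d, ‖covGrad Ω κ A' ψb j x‖ ^ 2 = 0 by linarith) j (Finset.mem_univ j)
      simpa using this
    · have : ‖ψb x‖ ^ 2 - 1 = 0 := (pow_eq_zero_iff two_ne_zero).1 (by linarith)
      exact (pow_eq_one_iff_of_nonneg (norm_nonneg _) two_ne_zero).1 (sub_eq_zero.1 this)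
    · simpa using (show ‖curl Ω A' x - H x‖ ^ 2 = 0 by linarith)
    · simpa using (show divergence Ω A' x ^ 2 = 0 by linarith)
  -- Zero energy kills every flux in the potential equation; tested with `A' - A`, only `τ⁻¹ ‖A' -
  -- A‖²` survives.
  have hAeq : A' =ᵐ[volume.restrict Ω] A := by
    have hform : ∀ᵐ x ∂(volume.restrict Ω), inner ℝ (τ⁻¹ • (A' x - A x)) (A' x - A x)
        + inner ℝ (curl Ω A' x - H x) (curl Ω (fun x => A' x - A x) x)
        + divergence Ω A' x * divergence Ω (fun x => A' x - A x) x
        + ∑ j : Fin d, (covGrad Ω κ A' ψb j x * star (((A' x - A x) j : ℂ) * ψb x)).re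
        = τ⁻¹ * ‖A' x - A x‖ ^ 2 := by
      filter_upwards [hzero] with x hx
      simp [hx.1, hx.2.2.1, hx.2.2.2, real_inner_smul_left, -PiLp.sub_apply]
    have := (integral_eq_zero_iff_of_nonneg_ae (hform.mono fun x hx => by
      simp only [Pi.zero_apply]; rw [hx]; positivity) i2).1 e2
    filter_upwards [hform, this] with x hx hx'
    simp only [Pi.zero_apply] at hx'
    rw [hx] at hx'
    have : τ⁻¹ ≠ 0 := by positivity
    simpa [this, sub_eq_zero] using hx'
  -- Now that `A' = A`, the covariant gradient of `ψb` with the old potential vanishes too, leaving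
  -- only the reaction terms, with `‖ψb‖ = 1`.
  have hψeq : ψb =ᵐ[volume.restrict Ω] ψ := by
    have hform : ∀ᵐ x ∂(volume.restrict Ω), ((η : ℂ) * ((ψb x - ψ x) / (τ : ℂ))
          * star (ψb x - ψ x)
        + (∑ j : Fin d, covGrad Ω κ A ψb j x
          * star (covGrad Ω κ A (fun x => ψb x - ψ x) j x))
        + (((‖ψ x‖ ^ 2 : ℝ) : ℂ) * ψb x - ψ x) * star (ψb x - ψ x)).re
        = (((η / τ : ℝ) : ℂ) * (ψb x - ψ x) * star (ψb x - ψ x)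
          + (((‖ψ x‖ ^ 2 : ℝ) : ℂ) * ψb x - ψ x) * star (ψb x - ψ x)).re := by
      filter_upwards [hzero, hAeq] with x hx hxA
      have e : (η : ℂ) * ((ψb x - ψ x) / (τ : ℂ)) = ((η / τ : ℝ) : ℂ) * (ψb x - ψ x) := by
        push_cast; ring
      have hcov (j) : covGrad Ω κ A ψb j x = 0 := by
        rw [← hx.1 j, covGrad, covGrad, hxA]
      rw [e]
      simp only [hcov, zero_mul, Finset.sum_const_zero, add_zero]
    have := (integral_eq_zero_iff_of_nonneg_ae (by
      filter_upwards [hform, hzero, hψ] with x hx hx0 hxψ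
      simp only [Pi.zero_apply, RCLike.re_to_complex]
      rw [hx]
      exact (re_reaction_nonneg_of_norm_eq_one hc hx0.2.1 hxψ).1) i1).1 e1
    filter_upwards [hform, hzero, hψ, this] with x hx hx0 hxψ hx'
    simp only [Pi.zero_apply, RCLike.re_to_complex] at hx'
    rw [hx] at hx'
    exact (re_reaction_nonneg_of_norm_eq_one hc hx0.2.1 hxψ).2 hx'
  rw [← h0, energy_congr κ H hψeq hAeq]

end Energy

/-! ### The auxiliary variable and the induction along the scheme. -/

section Scheme

variable {d : ℕ} {Ω : Set (E d)} {κ η τ : ℝ} {H : E d → E (d.choose 2)} {s : Iterates d} {n : ℕ}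

/-- Turns the sign conditions of cases 3 and 4 into a comparison of the new energy with the old `r`.
-/
theorem Iterates.IsStep.rtilde_add (h : s.IsStep Ω κ η τ H n) (hτ : 0 < τ) :
    s.rtilde (n + 1) + τ * (s.rtilde (n + 1) / s.Gbar Ω κ H (n + 1)) * s.Kbar Ω τ n = s.r n := by
  have := h.rtilde_eq
  rw [div_eq_iff hτ.ne'] at this
  linarith

/-- The factor is at least one, even for vanishing `Gbar`, where the quotient reads as zero. Hence
`rtilde` inherits the sign of the old `r` and, if nonnegative, does not exceed it. -/
theorem Iterates.IsStep.rtilde_mul (h : s.IsStep Ω κ η τ H n) (hτ : 0 < τ) :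
    s.rtilde (n + 1) * (1 + τ * (s.Kbar Ω τ n / s.Gbar Ω κ H (n + 1))) = s.r n := by
  rw [← h.rtilde_add hτ]
  ring

theorem Iterates.one_le_rtilde_factor (hτ : 0 < τ) :
    1 ≤ 1 + τ * (s.Kbar Ω τ n / s.Gbar Ω κ H (n + 1)) :=
  le_add_of_nonneg_right
    (mul_nonneg hτ.le (div_nonneg (dissipation_nonneg _ _ _ _ _) (energy_nonneg _ _ _ _)))

theorem Iterates.IsStep.rtilde_nonneg (h : s.IsStep Ω κ η τ H n) (hτ : 0 < τ) (hr : 0 ≤ s.r n) :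
    0 ≤ s.rtilde (n + 1) := by
  rw [← h.rtilde_mul hτ] at hr
  exact nonneg_of_mul_nonneg_left hr (zero_lt_one.trans_le (one_le_rtilde_factor hτ))

theorem Iterates.IsStep.rtilde_pos (h : s.IsStep Ω κ η τ H n) (hτ : 0 < τ) (hr : 0 < s.r n) :
    0 < s.rtilde (n + 1) := by
  rw [← h.rtilde_mul hτ] at hr
  exact pos_of_mul_pos_left hr (zero_le_one.trans (one_le_rtilde_factor hτ))

theorem Iterates.IsStep.rtilde_le (h : s.IsStep Ω κ η τ H n) (hτ : 0 < τ)
    (hr : 0 ≤ s.rtilde (n + 1)) : s.rtilde (n + 1) ≤ s.r n := by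
  rw [← h.rtilde_mul hτ]
  exact le_mul_of_one_le_right hr (one_le_rtilde_factor hτ)

/-- In the cases 1-3 the auxiliary variable is reset to the energy, which is at most its
previous value. -/
theorem Iterates.IsStep.r_eq_of_case (h : s.IsStep Ω κ η τ H n) (hτ : 0 < τ)
    (hc : s.Case1 Ω κ H n ∨ s.Case2 Ω κ H n ∨ s.Case3 Ω κ τ H n) :
    s.r (n + 1) = s.G Ω κ H (n + 1) ∧ s.G Ω κ H (n + 1) ≤ s.r n := by
  have hα : s.α₀ (n + 1) = 0 := by
    rcases hc with hc | hc | hc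
    · exact (h.case1 hc).1
    · exact (h.case2 hc).1
    · exact (h.case3 hc).1
  refine ⟨by rw [h.r_eq, hα]; ring, ?_⟩
  have hG : 0 ≤ s.G Ω κ H (n + 1) := energy_nonneg _ _ _ _
  rcases hc with hc | hc | hc
  · unfold Case1 at hc
    exact hc ▸ h.rtilde_le hτ (hc ▸ hG)
  · exact hc.le.trans (h.rtilde_le hτ (hG.trans hc.le))
  · linarith [hc.2, h.rtilde_add hτ]

/-- In case 4 the auxiliary variable is conserved. -/
theorem Iterates.IsStep.r_eq_of_case4 (h : s.IsStep Ω κ η τ H n) (hτ : 0 < τ)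
    (hc : s.Case4 Ω κ τ H n) : s.r (n + 1) = s.r n ∧ s.r n < s.G Ω κ H (n + 1) := by
  refine ⟨?_, by linarith [hc.2, h.rtilde_add hτ]⟩
  rw [h.r_eq, (h.case4 hc).1, ← h.rtilde_add hτ]
  have : s.G Ω κ H (n + 1) - s.rtilde (n + 1) ≠ 0 := (sub_pos.2 hc.1).ne'
  -- `α₀` is chosen so that `(1 - α₀)(G - rtilde)` is exactly the amount by which `rtilde` fell
  -- below the old `r`.
  have e : τ * s.rtilde (n + 1) * s.Kbar Ω τ n
      / (s.Gbar Ω κ H (n + 1) * (s.G Ω κ H (n + 1) - s.rtilde (n + 1)))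
      = τ * (s.rtilde (n + 1) / s.Gbar Ω κ H (n + 1)) * s.Kbar Ω τ n
        / (s.G Ω κ H (n + 1) - s.rtilde (n + 1)) := by
    rw [← div_div]
    ring
  rw [e]
  field_simp
  ring

theorem Iterates.case_or_case4 (s : Iterates d) (n : ℕ) :
    (s.Case1 Ω κ H n ∨ s.Case2 Ω κ H n ∨ s.Case3 Ω κ τ H n) ∨ s.Case4 Ω κ τ H n := by
  rcases lt_trichotomy (s.rtilde (n + 1)) (s.G Ω κ H (n + 1)) with h | h | h
  · rcases le_or_gt 0 (s.rtilde (n + 1) - s.G Ω κ H (n + 1)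
      + τ * (s.rtilde (n + 1) / s.Gbar Ω κ H (n + 1)) * s.Kbar Ω τ n) with h' | h'
    · exact .inl (.inr (.inr ⟨h, h'⟩))
    · exact .inr ⟨h, h'⟩
  · exact .inl (.inl h)
  · exact .inl (.inr (.inl h))

theorem Iterates.IsScheme.r_bounds {M : ℕ} (hs : s.IsScheme Ω κ η τ H M) (hτ : 0 < τ)
    (hn : n ≤ M) : 0 ≤ s.r n ∧ s.r n ≤ s.G Ω κ H n := by
  induction n with
  | zero => exact ⟨hs.r_zero ▸ energy_nonneg _ _ _ _, hs.r_zero.le⟩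
  | succ n ih =>
    have hn' := hs.step n hn
    rcases s.case_or_case4 (Ω := Ω) (κ := κ) (τ := τ) (H := H) n with hc | hc
    · obtain ⟨h1, -⟩ := hn'.r_eq_of_case hτ hc
      exact ⟨h1 ▸ energy_nonneg _ _ _ _, h1.le⟩
    · obtain ⟨h1, h2⟩ := hn'.r_eq_of_case4 hτ hc
      exact ⟨h1 ▸ (ih (Nat.le_of_succ_le hn)).1, h1 ▸ h2.le⟩

theorem Iterates.IsStep.ζ_nonneg (h : s.IsStep Ω κ η τ H n) (hτ : 0 < τ) (hr : 0 ≤ s.r n) :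
    0 ≤ s.ζ (n + 1) := by
  rw [h.ζ_eq]
  exact le_min (div_nonneg (h.rtilde_nonneg hτ hr) (energy_nonneg _ _ _ _)) (by positivity)

/-- From `0 ≤ ζ ≤ 1 + √2` follows `(1 - ζ)² ≤ 2`; this is the purpose of the truncation level. -/
theorem Iterates.IsStep.abs_ξ_le_one (h : s.IsStep Ω κ η τ H n) (hτ : 0 < τ) (hr : 0 ≤ s.r n) :
    |s.ξ (n + 1)| ≤ 1 := by
  have h0 := h.ζ_nonneg hτ hr
  have h1 : s.ζ (n + 1) ≤ 1 + √2 := h.ζ_eq ▸ min_le_right _ _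
  have h2 : √2 ^ 2 = 2 := Real.sq_sqrt (by norm_num)
  have h3 : 1 ≤ √2 := Real.one_le_sqrt.2 (by norm_num)
  rw [Iterates.ξ, abs_le]
  constructor <;> nlinarith

variable [IsFiniteMeasure ((volume : Measure (E d)).restrict Ω)]

theorem Iterates.IsScheme.regularity {M : ℕ} (hs : s.IsScheme Ω κ η τ H M) (hΩ : IsOpen Ω)
    (hτ : 0 < τ) (hτη : τ ≤ η) (hψ₀ : ∀ᵐ x ∂(volume.restrict Ω), ‖s.ψ 0 x‖ ≤ 1) (hn : n ≤ M) :
    MemH1n Ω (s.A n) ∧ MemMagH1 Ω (s.A n) (s.ψ n) ∧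
      ∀ᵐ x ∂(volume.restrict Ω), ‖s.ψ n x‖ ≤ 1 := by
  induction n with
  | zero => exact ⟨hs.A_zero, memMagH1_of_bounded hs.A_zero.1 hs.ψ_zero hψ₀, hψ₀⟩
  | succ n ih =>
    obtain ⟨hA, hψA, hψ⟩ := ih (Nat.le_of_succ_le hn)
    have h := hs.step n hn
    have hψb := h.order_parameter.norm_le_one hΩ hτ hτη hA.1 hψA.1.1 hψ
    have hξ := h.abs_ξ_le_one hτ (hs.r_bounds hτ (Nat.le_of_succ_le hn)).1
    refine ⟨h.potential.1, (h.potential.2.1.const_mul hΩ _).congr h.ψ_eq.symm, ?_⟩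
    filter_upwards [h.ψ_eq, hψb] with x hx hxb
    rw [hx, norm_mul, Complex.norm_real, Real.norm_eq_abs]
    exact mul_le_one₀ hξ (norm_nonneg _) hxb

/-- Invariance under a global phase; it covers `ξ = ±1`. -/
theorem energy_const_mul (hΩ : IsOpen Ω) {ψ : E d → ℂ} (hψ : MemH1 Ω ψ) (A : E d → E d) {c : ℂ}
    (hc : ‖c‖ = 1) : energy Ω κ H (fun x => c * ψ x) A = energy Ω κ H ψ A := by
  refine integral_congr_ae ?_
  filter_upwards [eventually_all.2 fun j => weakPartial_const_mul_ae_eq hΩ hψ c j] with x hx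
  have hcov (j) : covGrad Ω κ A (fun x => c * ψ x) j x = c * covGrad Ω κ A ψ j x := by
    rw [covGrad, covGrad, hx j]
    ring
  simp only [hcov, norm_mul, hc, one_mul]

/-- If a rescaling with factor of modulus at most one of a function bounded by one has zero
energy, then so does the function itself. -/
theorem energy_eq_zero_of_const_mul (hΩ : IsOpen Ω) (hH : MemLp H 2 (volume.restrict Ω))
    {ψ : E d → ℂ} {A : E d → E d} (hA : MemH1 Ω A) (hψ : MemMagH1 Ω A ψ)
    (hψ1 : ∀ᵐ x ∂(volume.restrict Ω), ‖ψ x‖ ≤ 1) {c : ℂ} (hc : ‖c‖ ≤ 1)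
    (h0 : energy Ω κ H (fun x => c * ψ x) A = 0) : energy Ω κ H ψ A = 0 := by
  rcases hc.eq_or_lt with hc1 | hc1
  · rwa [energy_const_mul hΩ hψ.1 A hc1] at h0
  · have hdens := (integral_eq_zero_iff_of_nonneg (energyDensity_nonneg κ H _ A)
      (integrable_energyDensity hH hA (hψ.const_mul hΩ c))).1 h0
    -- If `‖c‖ < 1` the rescaled function has modulus below one, so its potential energy density is
    -- positive. Zero energy is then possible only if `Ω` is a null set, where every energy is zero.
    have hfalse : ∀ᵐ x ∂(volume.restrict Ω), False := by
      filter_upwards [hdens, hψ1] with x hx hx1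
      simp only [energyDensity, Pi.zero_apply] at hx
      have a1 : 0 ≤ ∑ j : Fin d, ‖covGrad Ω κ A (fun x => c * ψ x) j x‖ ^ 2 := by positivity
      have a3 := sq_nonneg ‖curl Ω A x - H x‖
      have a4 := sq_nonneg (divergence Ω A x)
      have hlt : ‖c * ψ x‖ < 1 := by
        rw [norm_mul]
        exact (mul_le_of_le_one_right (norm_nonneg _) hx1).trans_lt hc1
      have : 0 < (‖c * ψ x‖ ^ 2 - 1) ^ 2 := by
        have : ‖c * ψ x‖ ^ 2 < 1 := pow_lt_one₀ (norm_nonneg _) hlt two_ne_zero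
        exact sq_pos_of_neg (by linarith)
      linarith
    refine integral_eq_zero_of_ae ?_
    filter_upwards [hfalse] with x hx
    exact hx.elim

end Scheme

end GLSAV

end

/-! ### Assembly of the three claims. -/

theorem theorem3p2 (d : ℕ) (hd : d = 2 ∨ d = 3)
    (Ω : Set (GLSAV.E d)) (hΩ_open : IsOpen Ω) (hΩ_bdd : Bornology.IsBounded Ω)
    (κ η τ : ℝ) (hκ : 0 < κ) (hη : 0 < η) (hτ : 0 < τ)
    (H : GLSAV.E d → GLSAV.E (d.choose 2)) (hH : MemLp H 2 (volume.restrict Ω))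
    (M : ℕ) (s : GLSAV.Iterates d) (hs : s.IsScheme Ω κ η τ H M)
    (hψ₀ : ∀ᵐ x ∂(volume.restrict Ω), ‖s.ψ 0 x‖ ≤ 1)
    (n : ℕ) (hn : n < M) :
    (τ ≤ η → 0 < s.r n → 0 < s.r (n + 1) ∧ 0 < s.ζ (n + 1)) ∧
    (s.Case1 Ω κ H n ∨ s.Case2 Ω κ H n ∨ s.Case3 Ω κ τ H n →
      GLSAV.energy Ω κ H (s.ψ (n + 1)) (s.A (n + 1)) ≤ GLSAV.energy Ω κ H (s.ψ n) (s.A n)) ∧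
    (τ ≤ η → s.Case4 Ω κ τ H n →
      GLSAV.energy Ω κ H (s.ψbar (n + 1)) (s.A (n + 1)) ≤
        GLSAV.energy Ω κ H (s.ψ n) (s.A n)) := by
  have : IsFiniteMeasure ((volume : Measure (GLSAV.E d)).restrict Ω) :=
    isFiniteMeasure_restrict.2 hΩ_bdd.measure_lt_top.ne
  have hstep := hs.step n hn
  obtain ⟨-, hrG⟩ := hs.r_bounds hτ hn.le
  refine ⟨fun hτη hr => ?_, fun hc => (hstep.r_eq_of_case hτ hc).2.trans hrG, fun hτη _ => ?_⟩
  · obtain ⟨hA, hψA, hψ⟩ := hs.regularity hΩ_open hτ hτη hψ₀ hn.le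
    have hψb := hstep.order_parameter.norm_le_one hΩ_open hτ hτη hA.1 hψA.1.1 hψ
    -- Strict positivity matters beyond the estimate: with `Gbar = 0` the quotient defining `ζ`
    -- would be read as zero.
    have hbar : 0 < s.Gbar Ω κ H (n + 1) := by
      refine lt_of_le_of_ne (GLSAV.energy_nonneg _ _ _ _) fun h0 => ?_
      have := GLSAV.energy_eq_zero_of_solves hΩ_open hτ hτη hH hA hψA hψ hstep.order_parameter
        hstep.potential h0.symm
      exact absurd (hr.trans_le hrG) (by rw [GLSAV.Iterates.G, this]; exact lt_irrefl _)
    refine ⟨?_, ?_⟩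
    · rcases s.case_or_case4 (Ω := Ω) (κ := κ) (τ := τ) (H := H) n with hc | hc
      · rw [(hstep.r_eq_of_case hτ hc).1]
        refine lt_of_le_of_ne (GLSAV.energy_nonneg _ _ _ _) fun h0 => hbar.ne' ?_
        rw [GLSAV.Iterates.G,
          GLSAV.energy_congr κ H hstep.ψ_eq (Filter.EventuallyEq.refl _ _)] at h0
        exact GLSAV.energy_eq_zero_of_const_mul hΩ_open hH hstep.potential.1.1 hstep.potential.2.1
          hψb (by rw [Complex.norm_real]; exact hstep.abs_ξ_le_one hτ hr.le) h0.symm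
      · exact (hstep.r_eq_of_case4 hτ hc).1 ▸ hr
    · rw [hstep.ζ_eq]
      exact lt_min (div_pos (hstep.rtilde_pos hτ hr) hbar) (by positivity)
  · obtain ⟨hA, hψA, hψ⟩ := hs.regularity hΩ_open hτ hτη hψ₀ hn.le
    exact GLSAV.energy_le_of_solves hΩ_open hτ hτη hH hA hψA hψ hstep.order_parameter
      hstep.potential
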